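/- Let $N\ge 1$, let $\omega\in\mathbb C$ be a primitive $N$-th root of unity and write $\mathbb Z_N=\mathbb Z/N\mathbb Z$. **Conventions.** A $\mathbb Z_N$-$C^*$-algebra is a unital $C^*$-algebra $X$ with a unital $*$-homomorphism $\rho^X:X\to X\otimes C(\mathbb Z_N)\cong C(\mathbb Z_N,X)$, $\rho^X(x)(t)=\rho^X_t(x)$, satisfying $(\rho^X\otimes\mathrm{id})\rho^X=(\mathrm{id}\otimes\Delta_{\mathbb Z_N})\rho^X$ and such that the closed linear span of $\rho^X(X)(1\otimes C(\mathbb Z_N))$ is $X\otimes C(\mathbb Z_N)$. A unital $*$-homomorphism $\phi:X\to Y$ is equivariant if $\rho^Y_t\circ\phi=\phi\circ\rho^X_t$ for all $t$. Let $X$ and $Y$ be faithfully represented on Hilbert spaces $\mathcal L^X,\mathcal L^Y$ carrying unitary representations $\pi^X,\pi^Y$ of $\mathbb Z_N$ such that $\rho_t(x)=\pi(t)\,x\,\pi(t)^*$ in each case. Let $c:\mathcal L^X\otimes\mathcal L^Y\to\mathcal L^Y\otimes\mathcal L^X$ be the unitary with $c(\xi\otimes\eta)=\omega^{mn}\,\eta\otimes\xi$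 whenever $\pi^X(t)\xi=\omega^{tm}\xi$ and $\pi^Y(t)\eta=\omega^{tn}\eta$ for all $t$. Put $j_1(x)=x\otimes\mathrm{id}$ and $j_2(y)=c^{-1}(y\otimes\mathrm{id})c$. The braided tensor product $X\boxtimes Y$ is the $C^*$-subalgebra of $\mathbb B(\mathcal L^X\otimes\mathcal L^Y)$ generated by the products $j_1(x)j_2(y)$. It is a $\mathbb Z_N$-$C^*$-algebra, with $\rho_t$ given by conjugation with $\pi^X(t)\otimes\pi^Y(t)$, and it is equivariantly represented on $\mathcal L^X\otimes\mathcal L^Y$. The morphisms $j_1,j_2$ are equivariant for this coaction. For equivariant $\phi:X\to X'$ and $\psi:Y\to Y'$, $\phi\boxtimes\psi:X\boxtimes Y\to X'\boxtimes Y'$ denotes the unique equivariant unital $*$-homomorphism with $(\phi\boxtimes\psi)(j_1(x)j_2(y))=j_1(\phi(x))j_2(\psi(y))$. The algebras $(X\boxtimes X)\boxtimes X$ and $X\boxtimes(X\boxtimes X)$ are identified through the associativity isomorphism of the Hilbert tensor product. An anyonic compact quantum group is a triple $(X,\rho,\Delta)$ in which $(X,\rho)$ is a $\mathbb Z_N$-$C^*$-algebra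 and $\Delta:X\to X\boxtimes X$ is an equivariant unital $*$-homomorphism that is coassociative, $(\Delta\boxtimes\mathrm{id})\Delta=(\mathrm{id}\boxtimes\Delta)\Delta$, and bisimplifiable: the closed linear spans of $\Delta(X)j_2(X)$ and of $\Delta(X)j_1(X)$ are both equal to $X\boxtimes X$. Let $C(U_N^+(R))$ be the universal unital $C^*$-algebra with generators $u_{ij}$, $i,j\in\mathbb Z_N$, subject to the relations making both $u=(u_{ij})$ and $\overline u_R=(\omega^{-i(j-i)}u_{ij}^*)$ unitary, with the coaction given by $\rho_t(u_{ij})=\omega^{t(j-i)}u_{ij}$. **Proposition.** $C(U_N^+(R))$ has a faithful equivariant representation as above. For every choice of such a representation (used for both factors of the braided tensor product) there is a unique unital $*$-homomorphism $$\Delta:C(U_N^+(R))\to C(U_N^+(R))\boxtimes C(U_N^+(R)),\qquad \Delta(u_{ij})=\sum_{k\in\mathbb Z_N}j_1(u_{ik})\,j_2(u_{kj})\quad(i,j\in\mathbb Z_N).$$ Moreover $\Delta$ is equivariant, coassociative and bisimplifiable. Hence $U_N^+(R)=(C(U_N^+(R)),\rho,\Delta)$ is an anyonic compact quantum group (the anyonic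 free unitary quantum group). -/

import Mathlib

noncomputable section

open scoped TensorProduct InnerProductSpace

set_option linter.unusedSectionVars false

/-! ### The free unital `*`-algebra -/

/-- The free unital complex `*`-algebra on a set `G` of generators: the free algebra on the letters
`(g, true)`, standing for `g`, and `(g, false)`, standing for the adjoint of `g`. -/
def FreeStar (G : Type) : Type := FreeAlgebra ℂ (G × Bool)

namespace FreeStar

variable {G : Type}

instance : Ring (FreeStar G) := inferInstanceAs (Ring (FreeAlgebra ℂ (G × Bool)))

instance : Algebra ℂ (FreeStar G) := inferInstanceAs (Algebra ℂ (FreeAlgebra ℂ (G × Bool)))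

/-- The letters: `(g, true)` is the generator `g` and `(g, false)` is its adjoint. -/
def letter (p : G × Bool) : FreeStar G := FreeAlgebra.ι ℂ p

/-- The generator `g`. -/
def gen (g : G) : FreeStar G := letter (g, true)

theorem induction {P : FreeStar G → Prop} (hs : ∀ c : ℂ, P (algebraMap ℂ (FreeStar G) c))
    (hl : ∀ p, P (letter p)) (hm : ∀ a b, P a → P b → P (a * b))
    (ha : ∀ a b, P a → P b → P (a + b)) (a : FreeStar G) : P a :=
  FreeAlgebra.induction (motive := P) ℂ (G × Bool) hs hl hm ha a

/-- The conjugate linear anti-endomorphism that exchanges each generator and its adjoint, as a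
ring homomorphism into the opposite ring. -/
def starHom : FreeStar G →+* (FreeStar G)ᵐᵒᵖ :=
  letI : Algebra ℂ (FreeStar G)ᵐᵒᵖ := Algebra.compHom _ (starRingEnd ℂ)
  (FreeAlgebra.lift ℂ fun p : G × Bool => MulOpposite.op (letter (p.1, !p.2)) :
    FreeAlgebra ℂ (G × Bool) →ₐ[ℂ] (FreeStar G)ᵐᵒᵖ).toRingHom

theorem starHom_letter (p : G × Bool) :
    starHom (letter p) = MulOpposite.op (letter (p.1, !p.2)) :=
  letI : Algebra ℂ (FreeStar G)ᵐᵒᵖ := Algebra.compHom _ (starRingEnd ℂ)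
  FreeAlgebra.lift_ι_apply (R := ℂ) (fun p : G × Bool => MulOpposite.op (letter (p.1, !p.2))) p

theorem starHom_algebraMap (c : ℂ) :
    starHom (algebraMap ℂ (FreeStar G) c)
      = MulOpposite.op (algebraMap ℂ (FreeStar G) (starRingEnd ℂ c)) :=
  letI : Algebra ℂ (FreeStar G)ᵐᵒᵖ := Algebra.compHom _ (starRingEnd ℂ)
  (FreeAlgebra.lift ℂ fun p : G × Bool => MulOpposite.op (letter (p.1, !p.2)) :
    FreeAlgebra ℂ (G × Bool) →ₐ[ℂ] (FreeStar G)ᵐᵒᵖ).commutes c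

instance : StarRing (FreeStar G) where
  star a := (starHom a).unop
  star_involutive a := by
    induction a using induction with
    | hs c => simp [starHom_algebraMap]
    | hl p => simp [starHom_letter]
    | hm a b iha ihb => simp [iha, ihb]
    | ha a b iha ihb => simp [iha, ihb]
  star_mul a b := by simp
  star_add a b := by simp

theorem star_def (a : FreeStar G) : star a = (starHom a).unop := rfl

instance : StarModule ℂ (FreeStar G) where
  star_smul c a := by
    rw [Algebra.smul_def, star_mul, star_def (algebraMap _ _ c), starHom_algebraMap,
      Algebra.smul_def, Algebra.commutes]
    rfl

variable {B : Type*} [Ring B] [Algebra ℂ B] [StarRing B] [StarModule ℂ B]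

/-- Evaluation of noncommutative `*`-polynomials, as an algebra homomorphism. -/
def liftAlg (v : G → B) : FreeStar G →ₐ[ℂ] B :=
  FreeAlgebra.lift ℂ fun p : G × Bool => if p.2 then v p.1 else star (v p.1)

theorem liftAlg_letter (v : G → B) (p : G × Bool) :
    liftAlg v (letter p) = if p.2 then v p.1 else star (v p.1) :=
  FreeAlgebra.lift_ι_apply (R := ℂ) (fun p : G × Bool => if p.2 then v p.1 else star (v p.1)) p

/-- Evaluation of noncommutative `*`-polynomials. -/
def lift (v : G → B) : FreeStar G →⋆ₐ[ℂ] B where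
  toAlgHom := liftAlg v
  map_star' a := by
    change liftAlg v (star a) = star (liftAlg v a)
    induction a using induction with
    | hs c =>
      rw [star_def, starHom_algebraMap, MulOpposite.unop_op, AlgHom.commutes, AlgHom.commutes,
        ← algebraMap_star_comm]
      rfl
    | hl p =>
      rw [star_def, starHom_letter, MulOpposite.unop_op, liftAlg_letter, liftAlg_letter]
      rcases p with ⟨g, b⟩
      cases b <;> simp
    | hm a b iha ihb => simp [iha, ihb]
    | ha a b iha ihb => simp [iha, ihb]

@[simp]
theorem lift_gen (v : G → B) (g : G) : lift v (gen g) = v g :=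
  (liftAlg_letter v (g, true)).trans (by simp)

theorem star_gen (g : G) : star (gen g) = letter (g, false) := by
  rw [star_def, gen, starHom_letter]; rfl

end FreeStar

/-! ### `C*`-seminorms and the completion -/

/-- A `C*`-seminorm on a complex `*`-algebra. -/
structure IsCStarSeminorm {F : Type*} [Ring F] [StarRing F] [Algebra ℂ F] (p : Seminorm ℂ F) :
    Prop where
  mul_le : ∀ a b, p (a * b) ≤ p a * p b
  star_mul_self : ∀ a, p (star a * a) = p a * p a

/-- A `*`-algebra `F`, topologized by the seminorm `p`. -/
def WithSN {F : Type*} [Ring F] [StarRing F] [Algebra ℂ F] {p : Seminorm ℂ F}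
    (_ : IsCStarSeminorm p) : Type _ := F

namespace WithSN

variable {F : Type*} [Ring F] [StarRing F] [Algebra ℂ F] [StarModule ℂ F] {p : Seminorm ℂ F}
  (hp : IsCStarSeminorm p)

instance : Ring (WithSN hp) := inferInstanceAs (Ring F)
instance : StarRing (WithSN hp) := inferInstanceAs (StarRing F)
instance : Algebra ℂ (WithSN hp) := inferInstanceAs (Algebra ℂ F)
instance : StarModule ℂ (WithSN hp) := inferInstanceAs (StarModule ℂ F)

/-- The identity map. -/
def toSN (a : F) : WithSN hp := a

/-- The identity map. -/
def ofSN (a : WithSN hp) : F := a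

instance : SeminormedRing (WithSN hp) where
  norm a := p (ofSN hp a)
  dist a b := p (ofSN hp a - ofSN hp b)
  dist_eq a b := by
    change p (ofSN hp a - ofSN hp b) = p (-ofSN hp a + ofSN hp b)
    rw [map_sub_rev, neg_add_eq_sub]
  dist_self a := by rw [sub_self, map_zero]
  dist_comm a b := map_sub_rev p _ _
  dist_triangle a b c := by
    have := map_add_le_add p (ofSN hp a - ofSN hp b) (ofSN hp b - ofSN hp c)
    rwa [sub_add_sub_cancel] at this
  norm_mul_le := hp.mul_le

theorem norm_toSN (a : F) : ‖toSN hp a‖ = p a := rfl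

instance : NormedAlgebra ℂ (WithSN hp) where
  __ : Algebra ℂ (WithSN hp) := inferInstance
  norm_smul_le c a := (map_smul_eq_mul p c a).le

theorem norm_star_le (a : WithSN hp) : ‖a‖ ≤ ‖star a‖ := by
  have h1 : ‖star a * a‖ = ‖a‖ * ‖a‖ := hp.star_mul_self a
  have h2 : ‖star a * a‖ ≤ ‖star a‖ * ‖a‖ := norm_mul_le _ _
  by_contra h
  push Not at h
  have h3 : 0 < ‖a‖ := lt_of_le_of_lt (norm_nonneg _) h
  nlinarith

theorem norm_star (a : WithSN hp) : ‖star a‖ = ‖a‖ :=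
  le_antisymm (by simpa using norm_star_le hp (star a)) (norm_star_le hp a)

/-- The adjoint as a continuous conjugate linear map. -/
def starL : WithSN hp →L⋆[ℂ] WithSN hp :=
  LinearMap.mkContinuous
    { toFun := fun a => star a
      map_add' := fun a b => star_add a b
      map_smul' := fun c a => star_smul c a } 1 fun a => by
        simpa using (norm_star hp a).le

@[simp]
theorem starL_apply (a : WithSN hp) : starL hp a = star a := rfl

end WithSN

/-- The Hausdorff completion of a `*`-algebra in a `C*`-seminorm. -/
def CStarCompletion {F : Type*} [Ring F] [StarRing F] [Algebra ℂ F] [StarModule ℂ F]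
    {p : Seminorm ℂ F} (hp : IsCStarSeminorm p) : Type _ :=
  UniformSpace.Completion (WithSN hp)

namespace CStarCompletion

open UniformSpace

variable {F : Type*} [Ring F] [StarRing F] [Algebra ℂ F] [StarModule ℂ F] {p : Seminorm ℂ F}
  (hp : IsCStarSeminorm p)

instance : NormedRing (CStarCompletion hp) := inferInstanceAs (NormedRing (Completion (WithSN hp)))

instance : CompleteSpace (CStarCompletion hp) :=
  inferInstanceAs (CompleteSpace (Completion (WithSN hp)))

instance : Algebra ℂ (CStarCompletion hp) :=
  inferInstanceAs (Algebra ℂ (Completion (WithSN hp)))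

instance : NormedAlgebra ℂ (CStarCompletion hp) where
  norm_smul_le := fun c (x : Completion (WithSN hp)) => norm_smul_le c x

/-- The canonical map into the completion. -/
def of (a : F) : CStarCompletion hp := Completion.coe' (WithSN.toSN hp a)

theorem norm_of (a : F) : ‖of hp a‖ = p a := Completion.norm_coe (WithSN.toSN hp a)

theorem denseRange_of : DenseRange (of hp) := Completion.denseRange_coe (α := WithSN hp)

theorem of_mul (a b : F) : of hp (a * b) = of hp a * of hp b :=
  Completion.coe_mul (α := WithSN hp) a b

theorem of_add (a b : F) : of hp (a + b) = of hp a + of hp b :=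
  Completion.coe_add (α := WithSN hp) a b

theorem of_smul (c : ℂ) (a : F) : of hp (c • a) = c • of hp a :=
  Completion.coe_smul (X := WithSN hp) c a

theorem of_one : of hp 1 = 1 := rfl

instance : Star (CStarCompletion hp) where
  star x := (WithSN.starL hp).completion x

theorem continuous_star' : Continuous fun x : CStarCompletion hp => star x :=
  (WithSN.starL hp).completion.continuous

theorem of_star (a : F) : of hp (star a) = star (of hp a) :=
  ((WithSN.starL hp).completion_apply_coe a).symm

theorem induction {P : CStarCompletion hp → Prop} (hc : IsClosed {x | P x})
    (h : ∀ a, P (of hp a)) (x : CStarCompletion hp) : P x :=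
  (denseRange_of hp).induction_on x hc h

instance : StarRing (CStarCompletion hp) where
  star_involutive x := by
    refine induction hp (P := fun x => star (star x) = x) ?_ ?_ x
    · exact isClosed_eq ((continuous_star' hp).comp (continuous_star' hp)) continuous_id
    · intro a
      rw [← of_star, ← of_star, star_star]
  star_add x y := (WithSN.starL hp).completion.map_add x y
  star_mul x y := by
    have hs := continuous_star' hp
    refine (denseRange_of hp).induction_on₂ (p := fun x y => star (x * y) = star y * star x)
      (isClosed_eq ?_ ?_) ?_ x y
    · exact hs.comp (continuous_fst.mul continuous_snd)
    · exact (hs.comp continuous_snd).mul (hs.comp continuous_fst)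
    · intro a b
      rw [← of_mul, ← of_star, ← of_star, ← of_star, ← of_mul, star_mul]

instance : StarModule ℂ (CStarCompletion hp) where
  star_smul c x := (WithSN.starL hp).completion.map_smulₛₗ c x

instance : CStarRing (CStarCompletion hp) where
  norm_mul_self_le x := by
    refine induction hp (P := fun x => ‖x‖ * ‖x‖ ≤ ‖star x * x‖) (isClosed_le ?_ ?_) ?_ x
    · exact continuous_norm.mul continuous_norm
    · exact continuous_norm.comp ((continuous_star' hp).mul continuous_id)
    · intro a
      rw [← of_star, ← of_mul, norm_of, norm_of, hp.star_mul_self]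

instance : CStarAlgebra (CStarCompletion hp) where

/-- The canonical map into the completion, as a unital `*`-homomorphism. -/
def ofHom : F →⋆ₐ[ℂ] CStarCompletion hp where
  toFun := of hp
  map_one' := of_one hp
  map_mul' := of_mul hp
  map_zero' := by simpa using of_smul hp 0 0
  map_add' := of_add hp
  commutes' c := by
    rw [Algebra.algebraMap_eq_smul_one, of_smul, of_one, Algebra.algebraMap_eq_smul_one]
  map_star' := of_star hp

/-- Extension of a unital `*`-homomorphism to the completion, as a continuous linear map. -/
def extendL {B : Type*} [CStarAlgebra B] (f : F →⋆ₐ[ℂ] B) (hf : ∀ a, ‖f a‖ ≤ p a) :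
    CStarCompletion hp →L[ℂ] B :=
  let L : WithSN hp →L[ℂ] B := LinearMap.mkContinuous (f.toAlgHom.toLinearMap) 1 fun a => by
    rw [one_mul]; exact hf a
  L.fromCompletion

theorem extendL_of {B : Type*} [CStarAlgebra B] (f : F →⋆ₐ[ℂ] B) (hf : ∀ a, ‖f a‖ ≤ p a)
    (a : F) : extendL hp f hf (of hp a) = f a :=
  ContinuousLinearMap.fromCompletion_apply_coe _ (WithSN.toSN hp a)

/-- Extension of a unital `*`-homomorphism to the completion. -/
def extend {B : Type*} [CStarAlgebra B] (f : F →⋆ₐ[ℂ] B) (hf : ∀ a, ‖f a‖ ≤ p a) :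
    CStarCompletion hp →⋆ₐ[ℂ] B where
  toFun := extendL hp f hf
  map_one' := by rw [← of_one, extendL_of, map_one]
  map_mul' x y := by
    have hc := (extendL hp f hf).continuous
    refine (denseRange_of hp).induction_on₂ (p := fun x y =>
      extendL hp f hf (x * y) = extendL hp f hf x * extendL hp f hf y)
      (isClosed_eq ?_ ?_) ?_ x y
    · exact hc.comp (continuous_fst.mul continuous_snd)
    · exact (hc.comp continuous_fst).mul (hc.comp continuous_snd)
    · intro a b
      rw [← of_mul, extendL_of, extendL_of, extendL_of, map_mul]
  map_zero' := map_zero _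
  map_add' x y := map_add _ x y
  commutes' c := by
    rw [Algebra.algebraMap_eq_smul_one, ← of_one, ← of_smul, extendL_of, map_smul, map_one,
      Algebra.algebraMap_eq_smul_one]
  map_star' x := by
    have hc := (extendL hp f hf).continuous
    refine induction hp (P := fun x => extendL hp f hf (star x) = star (extendL hp f hf x))
      (isClosed_eq ?_ ?_) ?_ x
    · exact hc.comp (continuous_star' hp)
    · exact hc.star
    · intro a
      rw [← of_star, extendL_of, extendL_of, map_star]

theorem extend_of {B : Type*} [CStarAlgebra B] (f : F →⋆ₐ[ℂ] B) (hf : ∀ a, ‖f a‖ ≤ p a) (a : F) :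
    extend hp f hf (of hp a) = f a :=
  extendL_of hp f hf a

end CStarCompletion

/-! ### Universal `C*`-algebras of generators and relations -/

/-- The `C*`-seminorms on the free `*`-algebra that vanish on the relations `R`, that is, the
`C*`-seminorms on the universal unital `*`-algebra with these generators and relations. -/
def cstarSeminorms {G : Type} (R : Set (FreeStar G)) : Set (Seminorm ℂ (FreeStar G)) :=
  {p | IsCStarSeminorm p ∧ ∀ r ∈ R, p r = 0}

/-- The largest of these `C*`-seminorms (zero if there is no largest one). -/
def maxSeminorm {G : Type} (R : Set (FreeStar G)) : Seminorm ℂ (FreeStar G) :=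
  sSup (cstarSeminorms R)

theorem isCStarSeminorm_maxSeminorm {G : Type} (R : Set (FreeStar G)) :
    IsCStarSeminorm (maxSeminorm R) := by
  have hz : IsCStarSeminorm (0 : Seminorm ℂ (FreeStar G)) := ⟨by simp, by simp⟩
  by_cases h : BddAbove (cstarSeminorms R)
  · have hne : Nonempty (cstarSeminorms R) := ⟨⟨0, hz, by simp⟩⟩
    have hle : ∀ p ∈ cstarSeminorms R, ∀ a, p a ≤ maxSeminorm R a :=
      fun p hp a => (le_csSup h hp) a
    have happ : ∀ a, maxSeminorm R a = ⨆ p : cstarSeminorms R, (p : FreeStar G → ℝ) a :=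
      fun a => Seminorm.sSup_apply h
    constructor
    · intro a b
      rw [happ (a * b)]
      refine ciSup_le fun p => (p.2.1.mul_le a b).trans ?_
      exact mul_le_mul (hle _ p.2 a) (hle _ p.2 b) (apply_nonneg _ _) (apply_nonneg _ _)
    · intro a
      refine le_antisymm ?_ ?_
      · rw [happ (star a * a)]
        refine ciSup_le fun p => ?_
        rw [p.2.1.star_mul_self]
        exact mul_le_mul (hle _ p.2 a) (hle _ p.2 a) (apply_nonneg _ _) (apply_nonneg _ _)
      · have h1 : maxSeminorm R a ≤ Real.sqrt (maxSeminorm R (star a * a)) := by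
          rw [happ a]
          refine ciSup_le fun p => Real.le_sqrt_of_sq_le ?_
          rw [sq, ← p.2.1.star_mul_self]
          exact hle _ p.2 _
        calc _ ≤ _ := mul_le_mul h1 h1 (apply_nonneg _ _) (Real.sqrt_nonneg _)
          _ = _ := Real.mul_self_sqrt (apply_nonneg _ _)
  · have : maxSeminorm R = 0 := by
      have h' := fun H => h (Seminorm.bddAbove_iff.mpr H)
      exact dif_neg h'
    rw [this]
    exact hz

/-- The universal unital `C*`-algebra with generators `G` and relations `R`. -/
abbrev UniversalCStar {G : Type} (R : Set (FreeStar G)) : Type :=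
  CStarCompletion (isCStarSeminorm_maxSeminorm R)

/-! ### Matrices, unitarity and the twisted conjugate -/

/-- The character value `ω ^ x` for `x` in `ℤ/Nℤ`. -/
def chi {N : ℕ} (ω : ℂ) (x : ZMod N) : ℂ := ω ^ x.val

section chi

variable {N : ℕ} [NeZero N] {ω : ℂ}

theorem chi_add (hω : IsPrimitiveRoot ω N) (x y : ZMod N) : chi ω (x + y) = chi ω x * chi ω y := by
  unfold chi
  rw [ZMod.val_add, ← pow_add]
  exact (pow_eq_pow_mod _ hω.pow_eq_one).symm

theorem star_chi (hω : IsPrimitiveRoot ω N) (x : ZMod N) : star (chi ω x) = chi ω (-x) := by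
  have h1 : chi ω x * chi ω (-x) = 1 := by
    rw [← chi_add hω, add_neg_cancel]
    simp [chi]
  have h2 : star (chi ω x) * chi ω x = 1 := by
    have hn : ‖ω‖ = 1 := hω.norm'_eq_one (NeZero.ne N)
    have hx : ‖chi ω x‖ = 1 := by simp [chi, hn]
    rw [Complex.star_def, Complex.conj_mul', hx]
    simp
  calc star (chi ω x) = star (chi ω x) * (chi ω x * chi ω (-x)) := by rw [h1, mul_one]
    _ = chi ω (-x) := by rw [← mul_assoc, h2, one_mul]

theorem sum_chi (hω : IsPrimitiveRoot ω N) (x : ZMod N) :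
    ∑ t : ZMod N, chi ω (t * x) = if x = 0 then (N : ℂ) else 0 := by
  split_ifs with hx
  · simp [hx, chi]
  · have h1 : chi ω x ≠ 1 := by
      intro h
      have hd := (hω.pow_eq_one_iff_dvd _).mp h
      have := Nat.eq_zero_of_dvd_of_lt hd (ZMod.val_lt x)
      exact hx ((ZMod.val_eq_zero x).mp this)
    have h2 : chi ω x * ∑ t : ZMod N, chi ω (t * x) = ∑ t : ZMod N, chi ω (t * x) := by
      rw [Finset.mul_sum]
      refine Fintype.sum_equiv (Equiv.addLeft 1) _ _ fun t => ?_
      rw [← chi_add hω, Equiv.coe_addLeft, add_mul, one_mul]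
    have h3 : (chi ω x - 1) * ∑ t : ZMod N, chi ω (t * x) = 0 := by
      rw [sub_mul, h2, one_mul, sub_self]
    exact (mul_eq_zero.mp h3).resolve_left (sub_ne_zero.mpr h1)

end chi

theorem chi_zero {N : ℕ} (ω : ℂ) : chi ω (0 : ZMod N) = 1 := by
  simp [chi]

section matrix

variable {N : ℕ} [NeZero N]

/-- The twisted conjugate `(ω ^ (-i(j-i)) v_ij^*)_ij` of a matrix `v`. -/
def twistedConj {B : Type*} [Star B] [SMul ℂ B] (ω : ℂ) (v : Matrix (ZMod N) (ZMod N) B) :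
    Matrix (ZMod N) (ZMod N) B :=
  Matrix.of fun i j => chi ω (-(i * (j - i))) • star (v i j)

/-- The elements that have to vanish for `v` to be unitary. -/
def unitaryRel {B : Type*} [Ring B] [StarRing B] (v : Matrix (ZMod N) (ZMod N) B) : Set B :=
  {r | ∃ i j, r = (star v * v - 1) i j ∨ r = (v * star v - 1) i j}

variable {A B : Type*} [Ring A] [StarRing A] [Algebra ℂ A] [StarModule ℂ A]
  [Ring B] [StarRing B] [Algebra ℂ B] [StarModule ℂ B]

theorem map_twistedConj (ω : ℂ) (φ : A →⋆ₐ[ℂ] B) (v : Matrix (ZMod N) (ZMod N) A) :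
    (twistedConj ω v).map φ = twistedConj ω (v.map φ) := by
  ext i j
  simp [twistedConj, map_star]

theorem map_mem_unitary_iff (φ : A →⋆ₐ[ℂ] B) (v : Matrix (ZMod N) (ZMod N) A) :
    v.map φ ∈ unitary (Matrix (ZMod N) (ZMod N) B) ↔ ∀ r ∈ unitaryRel v, φ r = 0 := by
  have e1 : star (v.map φ) * v.map φ - 1 = (star v * v - 1).map φ := by
    ext i j
    simp [Matrix.mul_apply, Matrix.one_apply, map_star, apply_ite φ, Matrix.star_apply]
  have e2 : v.map φ * star (v.map φ) - 1 = (v * star v - 1).map φ := by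
    ext i j
    simp [Matrix.mul_apply, Matrix.one_apply, map_star, apply_ite φ, Matrix.star_apply]
  rw [Unitary.mem_iff, ← sub_eq_zero, e1, ← sub_eq_zero (a := v.map φ * _), e2]
  constructor
  · rintro ⟨h1, h2⟩ r ⟨i, j, rfl | rfl⟩
    · exact congrFun (congrFun h1 i) j
    · exact congrFun (congrFun h2 i) j
  · intro h
    exact ⟨Matrix.ext fun i j => h _ ⟨i, j, Or.inl rfl⟩,
      Matrix.ext fun i j => h _ ⟨i, j, Or.inr rfl⟩⟩

theorem diag_mem_unitary {d : ZMod N → ℂ} (hd : ∀ i, star (d i) * d i = 1)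
    {v : Matrix (ZMod N) (ZMod N) B} (hv : v ∈ unitary (Matrix (ZMod N) (ZMod N) B)) :
    (Matrix.of fun i j => (star (d i) * d j) • v i j) ∈ unitary (Matrix (ZMod N) (ZMod N) B) := by
  have hd' : ∀ i, d i * star (d i) = 1 := fun i => by rw [mul_comm]; exact hd i
  have hD : Matrix.diagonal (fun i => algebraMap ℂ B (d i)) ∈
      unitary (Matrix (ZMod N) (ZMod N) B) := by
    rw [Unitary.mem_iff, Matrix.star_eq_conjTranspose, Matrix.diagonal_conjTranspose,
      Matrix.diagonal_mul_diagonal, Matrix.diagonal_mul_diagonal]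
    constructor
    · rw [← Matrix.diagonal_one]
      congr 1
      ext i
      rw [Pi.star_apply, ← algebraMap_star_comm, ← map_mul, hd, map_one]
    · rw [← Matrix.diagonal_one]
      congr 1
      ext i
      rw [Pi.star_apply, ← algebraMap_star_comm, ← map_mul, hd', map_one]
  have e : (Matrix.of fun i j => (star (d i) * d j) • v i j) =
      star (Matrix.diagonal fun i => algebraMap ℂ B (d i)) * v *
        Matrix.diagonal fun i => algebraMap ℂ B (d i) := by
    ext i j
    rw [Matrix.mul_diagonal, Matrix.star_eq_conjTranspose, Matrix.diagonal_conjTranspose,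
      Matrix.diagonal_mul, Pi.star_apply, ← algebraMap_star_comm, ← Algebra.commutes,
      Matrix.of_apply, Algebra.smul_def, map_mul, ← mul_assoc, ← map_mul, ← map_mul, mul_comm]
  rw [e]
  exact mul_mem (mul_mem (Unitary.star_mem hD) hv) hD

end matrix

theorem norm_entry_le_one {n : Type*} [Fintype n] [DecidableEq n] {B : Type*} [CStarAlgebra B]
    {v : Matrix n n B} (hv : v ∈ unitary (Matrix n n B)) (i j : n) : ‖v i j‖ ≤ 1 := by
  let _ := CStarAlgebra.spectralOrder B
  have _ := CStarAlgebra.spectralOrderedRing B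
  have h1 : ∑ k, star (v k j) * v k j = 1 := by
    have := congrFun (congrFun (Unitary.mem_iff.mp hv).1 j) j
    simpa [Matrix.mul_apply, Matrix.star_apply] using this
  have h2 : star (v i j) * v i j ≤ 1 := by
    rw [← h1]
    exact Finset.single_le_sum (f := fun k => star (v k j) * v k j)
      (fun k _ => star_mul_self_nonneg _) (Finset.mem_univ i)
  have h3 : ‖star (v i j) * v i j‖ ≤ 1 :=
    CStarAlgebra.norm_le_one_iff_of_nonneg _ (star_mul_self_nonneg _) |>.mpr h2
  rw [CStarRing.norm_star_mul_self] at h3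
  nlinarith [norm_nonneg (v i j)]

open scoped CStarAlgebra in
theorem continuous_hom {A B : Type*} [CStarAlgebra A] [CStarAlgebra B] (f : A →⋆ₐ[ℂ] B) :
    Continuous f :=
  map_continuous f

/-! ### The algebra `C(U_N^+(R))` -/

section freeUnitary

variable (N : ℕ) [NeZero N] (ω : ℂ)

/-- The matrix of generators in the free `*`-algebra. -/
def freeMatrix : Matrix (ZMod N) (ZMod N) (FreeStar (ZMod N × ZMod N)) :=
  Matrix.of fun i j => FreeStar.gen (i, j)

/-- The relations that make the matrix of generators and its twisted conjugate unitary. -/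
def freeUnitaryRel : Set (FreeStar (ZMod N × ZMod N)) :=
  unitaryRel (freeMatrix N) ∪ unitaryRel (twistedConj ω (freeMatrix N))

/-- The algebra `C(U_N^+(R))`: the universal unital `C*`-algebra whose generators `u_ij` make both
`u` and its twisted conjugate unitary. -/
abbrev FreeUnitary : Type := UniversalCStar (freeUnitaryRel N ω)

namespace FreeUnitary

/-- The matrix `u` of canonical generators. -/
def u : Matrix (ZMod N) (ZMod N) (FreeUnitary N ω) :=
  Matrix.of fun i j =>
    CStarCompletion.of (isCStarSeminorm_maxSeminorm (freeUnitaryRel N ω)) (FreeStar.gen (i, j))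

theorem bddAbove_cstarSeminorms : BddAbove (cstarSeminorms (freeUnitaryRel N ω)) := by
  rw [Seminorm.bddAbove_iff]
  have hl : ∀ p ∈ cstarSeminorms (freeUnitaryRel N ω), ∀ q, p (FreeStar.letter q) ≤ 1 := by
    intro p hp q
    have hU : (freeMatrix N).map (CStarCompletion.ofHom hp.1) ∈ unitary (Matrix _ _ _) :=
      (map_mem_unitary_iff _ _).mpr fun r hr => norm_eq_zero.mp
        ((CStarCompletion.norm_of hp.1 r).trans (hp.2 r (Or.inl hr)))
    have hg : ‖CStarCompletion.ofHom hp.1 (FreeStar.gen q.1)‖ ≤ 1 :=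
      norm_entry_le_one hU q.1.1 q.1.2
    rw [← CStarCompletion.norm_of hp.1]
    rcases q with ⟨g, b⟩
    cases b
    · rw [← FreeStar.star_gen, CStarCompletion.of_star, norm_star]
      exact hg
    · exact hg
  have hb : ∀ a, ∃ C, ∀ p ∈ cstarSeminorms (freeUnitaryRel N ω), p a ≤ C := by
    intro a
    induction a using FreeStar.induction with
    | hs c =>
      refine ⟨‖c‖, fun p hp => ?_⟩
      rw [Algebra.algebraMap_eq_smul_one, map_smul_eq_mul]
      have h1 := hp.1.star_mul_self 1
      rw [star_one, mul_one] at h1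
      have h2 : p 1 ≤ 1 := by nlinarith [apply_nonneg p 1, sq_nonneg (p 1 - 1)]
      exact mul_le_of_le_one_right (norm_nonneg c) h2
    | hl q => exact ⟨1, fun p hp => hl p hp q⟩
    | hm a b iha ihb =>
      obtain ⟨C, hC⟩ := iha
      obtain ⟨D, hD⟩ := ihb
      refine ⟨C * D, fun p hp => (hp.1.mul_le a b).trans ?_⟩
      exact mul_le_mul (hC p hp) (hD p hp) (apply_nonneg p b)
        ((apply_nonneg p a).trans (hC p hp))
    | ha a b iha ihb =>
      obtain ⟨C, hC⟩ := iha
      obtain ⟨D, hD⟩ := ihb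
      exact ⟨C + D, fun p hp => (map_add_le_add p a b).trans (add_le_add (hC p hp) (hD p hp))⟩
  choose C hC using hb
  refine ⟨C, ?_⟩
  rintro _ ⟨p, hp, rfl⟩ a
  exact hC a p hp

theorem maxSeminorm_rel {r : FreeStar (ZMod N × ZMod N)} (hr : r ∈ freeUnitaryRel N ω) :
    maxSeminorm (freeUnitaryRel N ω) r = 0 := by
  have hne : Nonempty (cstarSeminorms (freeUnitaryRel N ω)) :=
    ⟨⟨0, ⟨by simp, by simp⟩, by simp⟩⟩
  refine le_antisymm ?_ (apply_nonneg _ _)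
  refine (Seminorm.sSup_apply (bddAbove_cstarSeminorms N ω)).trans_le ?_
  exact ciSup_le fun p => (p.2.2 r hr).le

theorem u_mem_unitary : u N ω ∈ unitary (Matrix (ZMod N) (ZMod N) (FreeUnitary N ω)) :=
  (map_mem_unitary_iff (CStarCompletion.ofHom _) (freeMatrix N)).mpr fun r hr =>
    norm_eq_zero.mp ((CStarCompletion.norm_of _ r).trans (maxSeminorm_rel N ω (Or.inl hr)))

theorem twistedConj_u_mem_unitary :
    twistedConj ω (u N ω) ∈ unitary (Matrix (ZMod N) (ZMod N) (FreeUnitary N ω)) := by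
  have := (map_mem_unitary_iff (CStarCompletion.ofHom
    (isCStarSeminorm_maxSeminorm (freeUnitaryRel N ω))) (twistedConj ω (freeMatrix N))).mpr
    fun r hr =>
    norm_eq_zero.mp ((CStarCompletion.norm_of _ r).trans (maxSeminorm_rel N ω (Or.inr hr)))
  rwa [map_twistedConj] at this

variable {N ω} {B : Type*} [CStarAlgebra B]

theorem norm_lift_le {v : Matrix (ZMod N) (ZMod N) B}
    (h1 : v ∈ unitary (Matrix (ZMod N) (ZMod N) B))
    (h2 : twistedConj ω v ∈ unitary (Matrix (ZMod N) (ZMod N) B))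
    (a : FreeStar (ZMod N × ZMod N)) :
    ‖FreeStar.lift (fun p : ZMod N × ZMod N => v p.1 p.2) a‖ ≤
      maxSeminorm (freeUnitaryRel N ω) a := by
  have h := fun r : Matrix (ZMod N) (ZMod N) (FreeStar (ZMod N × ZMod N)) =>
    (map_mem_unitary_iff (FreeStar.lift fun p : ZMod N × ZMod N => v p.1 p.2) r).mp
  have hm : (freeMatrix N).map (FreeStar.lift fun p : ZMod N × ZMod N => v p.1 p.2) = v := by
    ext i j
    simp [freeMatrix]
  let q : Seminorm ℂ (FreeStar (ZMod N × ZMod N)) := (normSeminorm ℂ B).comp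
    (FreeStar.lift fun p : ZMod N × ZMod N => v p.1 p.2).toAlgHom.toLinearMap
  have hq : ∀ a, q a = ‖FreeStar.lift (fun p : ZMod N × ZMod N => v p.1 p.2) a‖ := fun a => rfl
  have hqmem : q ∈ cstarSeminorms (freeUnitaryRel N ω) := by
    refine ⟨⟨fun a b => ?_, fun a => ?_⟩, fun r hr => ?_⟩
    · rw [hq, hq, hq, map_mul]
      exact norm_mul_le _ _
    · rw [hq, hq, map_mul, map_star, CStarRing.norm_star_mul_self]
    · rw [hq, norm_eq_zero]
      rcases hr with hr | hr
      · exact h _ (by rwa [hm]) r hr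
      · exact h _ (by rwa [map_twistedConj, hm]) r hr
  exact le_csSup (bddAbove_cstarSeminorms N ω) hqmem a

/-- The universal property: matrices that are unitary together with their twisted conjugate are
the images of `u` under unital `*`-homomorphisms. -/
def lift (v : Matrix (ZMod N) (ZMod N) B)
    (h1 : v ∈ unitary (Matrix (ZMod N) (ZMod N) B))
    (h2 : twistedConj ω v ∈ unitary (Matrix (ZMod N) (ZMod N) B)) : FreeUnitary N ω →⋆ₐ[ℂ] B :=
  CStarCompletion.extend _ (FreeStar.lift fun p : ZMod N × ZMod N => v p.1 p.2)
    (norm_lift_le h1 h2)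

theorem lift_u (v : Matrix (ZMod N) (ZMod N) B)
    (h1 : v ∈ unitary (Matrix (ZMod N) (ZMod N) B))
    (h2 : twistedConj ω v ∈ unitary (Matrix (ZMod N) (ZMod N) B)) (i j : ZMod N) :
    lift v h1 h2 (u N ω i j) = v i j :=
  (CStarCompletion.extend_of _ _ _ _).trans (FreeStar.lift_gen _ _)

theorem hom_ext {f g : FreeUnitary N ω →⋆ₐ[ℂ] B} (h : ∀ i j, f (u N ω i j) = g (u N ω i j)) :
    f = g := by
  have key : ∀ a, f (CStarCompletion.of _ a) = g (CStarCompletion.of _ a) := by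
    intro a
    change f (CStarCompletion.ofHom _ a) = g (CStarCompletion.ofHom _ a)
    induction a using FreeStar.induction with
    | hs c => simp only [AlgHomClass.commutes]
    | hl q =>
      rcases q with ⟨⟨i, j⟩, b⟩
      cases b
      · rw [← FreeStar.star_gen, map_star, map_star, map_star]
        exact congrArg star (h i j)
      · exact h i j
    | hm a b iha ihb => rw [map_mul, map_mul, map_mul, iha, ihb]
    | ha a b iha ihb => rw [map_add, map_add, map_add, iha, ihb]
  have hf : Continuous f := continuous_hom f
  have hg : Continuous g := continuous_hom g
  ext x
  exact CStarCompletion.induction _ (P := fun x => f x = g x)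
    (isClosed_eq hf hg) key x

end FreeUnitary

end freeUnitary

/-! ### Actions of `ℤ/Nℤ` on unital `C*`-algebras -/

/-- A coaction of `C(ℤ/Nℤ)` on a unital `C*`-algebra `X`, where `X ⊗ C(ℤ/Nℤ)` is identified with the
algebra of all functions `ℤ/Nℤ → X`; the comultiplication of `C(ℤ/Nℤ)` is dual to the addition of
`ℤ/Nℤ`. -/
structure ZNAction (N : ℕ) [NeZero N] (X : Type*) [CStarAlgebra X] where
  /-- The coaction. -/
  ρ : X →⋆ₐ[ℂ] (ZMod N → X)
  /-- Coassociativity. -/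
  coassoc : ∀ x s t, ρ (ρ x t) s = ρ x (s + t)
  /-- The elements `ρ x * (1 ⊗ f)` span a dense subspace. -/
  podles : (Submodule.span ℂ {F : ZMod N → X | ∃ (x : X) (f : ZMod N → ℂ),
    F = ρ x * fun t => algebraMap ℂ X (f t)}).topologicalClosure = ⊤

namespace ZNAction

variable {N : ℕ} [NeZero N] {X Y : Type*} [CStarAlgebra X] [CStarAlgebra Y]

/-- The coaction that belongs to a group action by automorphisms. -/
def ofFamily (σ : ZMod N → X →⋆ₐ[ℂ] X) (h0 : ∀ x, σ 0 x = x)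
    (hadd : ∀ s t x, σ s (σ t x) = σ (s + t) x) : ZNAction N X where
  ρ :=
    { toFun := fun x t => σ t x
      map_one' := by ext; simp
      map_mul' := fun x y => by ext; simp
      map_zero' := by ext; simp
      map_add' := fun x y => by ext; simp
      commutes' := fun c => by ext; simp [Algebra.algebraMap_eq_smul_one]
      map_star' := fun x => by ext; simp [map_star] }
  coassoc x s t := hadd s t x
  podles := by
    refine Submodule.eq_top_iff'.mpr fun y => Submodule.le_topologicalClosure _ ?_
    have hy : y = ∑ t, Pi.single t (y t) := (Finset.univ_sum_single y).symm
    rw [hy]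
    refine Submodule.sum_mem _ fun t _ => Submodule.subset_span
      ⟨σ (-t) (y t), fun s => if s = t then 1 else 0, ?_⟩
    ext s
    by_cases hs : s = t
    · subst hs
      simp [hadd, h0]
    · simp [hs]

/-- Equivariance of a unital `*`-homomorphism. -/
def IsEquivariant (α : ZNAction N X) (β : ZNAction N Y) (φ : X →⋆ₐ[ℂ] Y) : Prop :=
  ∀ x t, β.ρ (φ x) t = φ (α.ρ x t)

end ZNAction

/-- The automorphism `u_ij ↦ ω ^ (t(j-i)) u_ij` of `C(U_N^+(R))`. -/
def FreeUnitary.rot {N : ℕ} [NeZero N] {ω : ℂ} (hω : IsPrimitiveRoot ω N) (t : ZMod N) :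
    FreeUnitary N ω →⋆ₐ[ℂ] FreeUnitary N ω :=
  FreeUnitary.lift (Matrix.of fun i j => chi ω (t * (j - i)) • FreeUnitary.u N ω i j)
    (by
      have := diag_mem_unitary (d := fun i => chi ω (t * i))
        (fun i => by rw [star_chi hω, ← chi_add hω, neg_add_cancel, chi_zero])
        (FreeUnitary.u_mem_unitary N ω)
      simpa only [star_chi hω, ← chi_add hω, ← mul_neg, ← mul_add, neg_add_eq_sub] using this)
    (by
      have := diag_mem_unitary (d := fun i => chi ω (-(t * i)))
        (fun i => by rw [star_chi hω, ← chi_add hω, neg_add_cancel, chi_zero])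
        (FreeUnitary.twistedConj_u_mem_unitary N ω)
      convert this using 1
      ext i j
      simp only [twistedConj, Matrix.of_apply, star_smul, smul_smul, star_chi hω, ← chi_add hω]
      congr 2
      ring)

theorem FreeUnitary.rot_u {N : ℕ} [NeZero N] {ω : ℂ} (hω : IsPrimitiveRoot ω N) (t i j : ZMod N) :
    FreeUnitary.rot hω t (FreeUnitary.u N ω i j)
      = chi ω (t * (j - i)) • FreeUnitary.u N ω i j :=
  FreeUnitary.lift_u _ _ _ i j

/-- The coaction on `C(U_N^+(R))`, with `ρ_t(u_ij) = ω ^ (t(j-i)) u_ij`. -/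
def FreeUnitary.action {N : ℕ} [NeZero N] {ω : ℂ} (hω : IsPrimitiveRoot ω N) :
    ZNAction N (FreeUnitary N ω) :=
  ZNAction.ofFamily (FreeUnitary.rot hω)
    (fun x => DFunLike.congr_fun (FreeUnitary.hom_ext (f := FreeUnitary.rot hω 0)
      (g := StarAlgHom.id ℂ _) fun i j => by
        rw [FreeUnitary.rot_u, zero_mul, chi_zero, one_smul]; rfl) x)
    (fun s t x => DFunLike.congr_fun (FreeUnitary.hom_ext
      (f := (FreeUnitary.rot hω s).comp (FreeUnitary.rot hω t))
      (g := FreeUnitary.rot hω (s + t)) fun i j => by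
        rw [StarAlgHom.comp_apply, FreeUnitary.rot_u, FreeUnitary.rot_u, map_smul,
          FreeUnitary.rot_u, smul_smul, add_mul, chi_add hω, mul_comm]) x)

/-! ### Hilbert space tensor products -/

section hilbert

open UniformSpace

variable {E F G H : Type*} [NormedAddCommGroup E] [InnerProductSpace ℂ E]
  [NormedAddCommGroup F] [InnerProductSpace ℂ F] [NormedAddCommGroup G] [InnerProductSpace ℂ G]
  [NormedAddCommGroup H] [InnerProductSpace ℂ H]

/-- The Hilbert space tensor product. -/
def HilbertTensor (E F : Type*) [NormedAddCommGroup E] [InnerProductSpace ℂ E]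
    [NormedAddCommGroup F] [InnerProductSpace ℂ F] : Type _ :=
  Completion (E ⊗[ℂ] F)

namespace HilbertTensor

instance : NormedAddCommGroup (HilbertTensor E F) :=
  inferInstanceAs (NormedAddCommGroup (Completion (E ⊗[ℂ] F)))

instance : InnerProductSpace ℂ (HilbertTensor E F) :=
  inferInstanceAs (InnerProductSpace ℂ (Completion (E ⊗[ℂ] F)))

instance : CompleteSpace (HilbertTensor E F) :=
  inferInstanceAs (CompleteSpace (Completion (E ⊗[ℂ] F)))

/-- The embedding of the algebraic tensor product. -/
def coeL (E F : Type*) [NormedAddCommGroup E] [InnerProductSpace ℂ E]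
    [NormedAddCommGroup F] [InnerProductSpace ℂ F] : E ⊗[ℂ] F →L[ℂ] HilbertTensor E F :=
  Completion.toComplL (𝕜 := ℂ) (E := E ⊗[ℂ] F)

theorem denseRange_coeL : DenseRange (coeL E F) := Completion.denseRange_coe (α := E ⊗[ℂ] F)

theorem norm_coeL (z : E ⊗[ℂ] F) : ‖coeL E F z‖ = ‖z‖ := Completion.norm_coe z

theorem inner_coeL (z w : E ⊗[ℂ] F) : inner ℂ (coeL E F z) (coeL E F w) = inner ℂ z w :=
  Completion.inner_coe z w

/-- The elementary tensor `x ⊗ y`. -/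
def tmul (x : E) (y : F) : HilbertTensor E F := coeL E F (x ⊗ₜ[ℂ] y)

theorem ext_tmul {X : Type*} [NormedAddCommGroup X] [NormedSpace ℂ X]
    {S T : HilbertTensor E F →L[ℂ] X}
    (h : ∀ x y, S (tmul x y) = T (tmul x y)) : S = T := by
  ext z
  refine denseRange_coeL.induction_on z (isClosed_eq S.continuous T.continuous) fun w => ?_
  induction w using TensorProduct.induction_on with
  | zero => simp
  | tmul x y => exact h x y
  | add a b ha hb => rw [map_add, map_add, map_add, ha, hb]

theorem inner_tmul (x x' : E) (y y' : F) :
    inner ℂ (tmul x y) (tmul x' y') = inner ℂ x x' * inner ℂ y y' := by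
  rw [tmul, tmul, inner_coeL, TensorProduct.inner_tmul]

theorem add_tmul (x x' : E) (y : F) : tmul (x + x') y = tmul x y + tmul x' y := by
  simp only [tmul, TensorProduct.add_tmul, map_add]

theorem tmul_add (x : E) (y y' : F) : tmul x (y + y') = tmul x y + tmul x y' := by
  simp only [tmul, TensorProduct.tmul_add, map_add]

theorem smul_tmul (c : ℂ) (x : E) (y : F) : tmul (c • x) y = c • tmul x y := by
  simp only [tmul, ← TensorProduct.smul_tmul', map_smul]

theorem tmul_smul (c : ℂ) (x : E) (y : F) : tmul x (c • y) = c • tmul x y := by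
  simp only [tmul, TensorProduct.tmul_smul, map_smul]

theorem zero_tmul (y : F) : tmul (0 : E) y = 0 := by
  simp only [tmul, TensorProduct.zero_tmul, map_zero]

theorem tmul_zero (x : E) : tmul x (0 : F) = 0 := by
  simp only [tmul, TensorProduct.tmul_zero, map_zero]

/-- The tensor product `S ⊗ T` of bounded operators. -/
def map (S : E →L[ℂ] G) (T : F →L[ℂ] H) : HilbertTensor E F →L[ℂ] HilbertTensor G H :=
  (TensorProduct.mapL S T).completion

theorem map_coeL (S : E →L[ℂ] G) (T : F →L[ℂ] H) (z : E ⊗[ℂ] F) :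
    map S T (coeL E F z) = coeL G H (TensorProduct.mapL S T z) :=
  ContinuousLinearMap.completion_apply_coe (TensorProduct.mapL S T) z

@[simp]
theorem map_tmul (S : E →L[ℂ] G) (T : F →L[ℂ] H) (x : E) (y : F) :
    map S T (tmul x y) = tmul (S x) (T y) :=
  map_coeL S T (x ⊗ₜ[ℂ] y)

/-- The flip `x ⊗ y ↦ y ⊗ x`. -/
def flip (E F : Type*) [NormedAddCommGroup E] [InnerProductSpace ℂ E]
    [NormedAddCommGroup F] [InnerProductSpace ℂ F] : HilbertTensor E F →L[ℂ] HilbertTensor F E :=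
  ((TensorProduct.commIsometry ℂ E F).toContinuousLinearEquiv :
    E ⊗[ℂ] F →L[ℂ] F ⊗[ℂ] E).completion

@[simp]
theorem flip_tmul (x : E) (y : F) : flip E F (tmul x y) = tmul y x :=
  ContinuousLinearMap.completion_apply_coe
    ((TensorProduct.commIsometry ℂ E F).toContinuousLinearEquiv : E ⊗[ℂ] F →L[ℂ] F ⊗[ℂ] E)
    (x ⊗ₜ[ℂ] y)

theorem map_one_one : map (1 : E →L[ℂ] E) (1 : F →L[ℂ] F) = 1 := ext_tmul fun x y => by simp

theorem map_mul_map (S S' : E →L[ℂ] E) (T T' : F →L[ℂ] F) :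
    map S T * map S' T' = map (S * S') (T * T') := ext_tmul fun x y => by simp

theorem adjoint_eq_of_tmul {S : HilbertTensor E F →L[ℂ] HilbertTensor G H}
    {T : HilbertTensor G H →L[ℂ] HilbertTensor E F}
    (h : ∀ x y x' y', inner ℂ (S (tmul x y)) (tmul x' y') = inner ℂ (tmul x y) (T (tmul x' y'))) :
    ContinuousLinearMap.adjoint S = T := by
  refine ((ContinuousLinearMap.eq_adjoint_iff T S).mpr fun v w => ?_).symm
  have h1 : ∀ x' y', (innerSL ℂ (T (tmul x' y')) : HilbertTensor E F →L[ℂ] ℂ) =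
      innerSL ℂ (tmul x' y') ∘L S := fun x' y' => ext_tmul fun x y => by
    have := congrArg (starRingEnd ℂ) (h x y x' y')
    simpa using this.symm
  have h2 : innerSL ℂ w ∘L T = innerSL ℂ (S w) := ext_tmul fun x' y' => by
    have := congrArg (starRingEnd ℂ) (DFunLike.congr_fun (h1 x' y') w)
    simpa using this
  have := congrArg (starRingEnd ℂ) (DFunLike.congr_fun h2 v)
  simpa using this

theorem star_map [CompleteSpace E] [CompleteSpace F] (S : E →L[ℂ] E) (T : F →L[ℂ] F) :
    star (map S T) = map (star S) (star T) := by
  refine adjoint_eq_of_tmul fun x y x' y' => ?_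
  rw [map_tmul, map_tmul, inner_tmul, inner_tmul, ContinuousLinearMap.star_eq_adjoint,
    ContinuousLinearMap.star_eq_adjoint, ContinuousLinearMap.adjoint_inner_right,
    ContinuousLinearMap.adjoint_inner_right]

theorem tmulL_left_continuous (y : F) : Continuous fun x : E => tmul x y :=
  (coeL E F).continuous.comp (((TensorProduct.mkL ℂ E F).flip y).continuous)

theorem tmulL_right_continuous (x : E) : Continuous fun y : F => tmul x y :=
  (coeL E F).continuous.comp ((TensorProduct.mkL ℂ E F x).continuous)

/-- A closed subspace that contains the elementary tensors is everything. -/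
theorem denseRange_of_tmul {V : Type*} [AddCommGroup V] [Module ℂ V]
    (f : V →ₗ[ℂ] HilbertTensor E F)
    (h : ∀ x y, tmul x y ∈ (LinearMap.range f).topologicalClosure) : DenseRange f := by
  have h1 : ∀ z, z ∈ (LinearMap.range f).topologicalClosure := by
    intro z
    refine denseRange_coeL.induction_on z
      (Submodule.isClosed_topologicalClosure (LinearMap.range f)) fun w => ?_
    induction w using TensorProduct.induction_on with
    | zero => simp
    | tmul x y => exact h x y
    | add a b ha hb => rw [map_add]; exact Submodule.add_mem _ ha hb
  intro z
  have := h1 z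
  rwa [← SetLike.mem_coe, Submodule.topologicalClosure_coe] at this

/-- The embedding of `(E ⊗ F) ⊗ G` with algebraic tensor products. -/
def coeL₁₂ (E F G : Type*) [NormedAddCommGroup E] [InnerProductSpace ℂ E]
    [NormedAddCommGroup F] [InnerProductSpace ℂ F] [NormedAddCommGroup G] [InnerProductSpace ℂ G] :
    (E ⊗[ℂ] F) ⊗[ℂ] G →L[ℂ] HilbertTensor (HilbertTensor E F) G :=
  coeL (HilbertTensor E F) G ∘L (coeL E F).rTensor G

/-- The embedding of `E ⊗ (F ⊗ G)` with algebraic tensor products. -/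
def coeL₂₃ (E F G : Type*) [NormedAddCommGroup E] [InnerProductSpace ℂ E]
    [NormedAddCommGroup F] [InnerProductSpace ℂ F] [NormedAddCommGroup G] [InnerProductSpace ℂ G] :
    E ⊗[ℂ] (F ⊗[ℂ] G) →L[ℂ] HilbertTensor E (HilbertTensor F G) :=
  coeL E (HilbertTensor F G) ∘L (coeL F G).lTensor E

theorem denseRange_coeL₁₂ : DenseRange (coeL₁₂ E F G).toLinearMap := by
  refine denseRange_of_tmul _ fun x y => ?_
  refine denseRange_coeL.induction_on x ?_ fun w => ?_
  · exact (Submodule.isClosed_topologicalClosure _).preimage (tmulL_left_continuous y)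
  · exact Submodule.le_topologicalClosure _ ⟨w ⊗ₜ[ℂ] y, rfl⟩

theorem denseRange_coeL₂₃ : DenseRange (coeL₂₃ E F G).toLinearMap := by
  refine denseRange_of_tmul _ fun x y => ?_
  refine denseRange_coeL.induction_on y ?_ fun w => ?_
  · exact (Submodule.isClosed_topologicalClosure _).preimage (tmulL_right_continuous x)
  · exact Submodule.le_topologicalClosure _ ⟨x ⊗ₜ[ℂ] w, rfl⟩

theorem norm_coeL₁₂ (z : (E ⊗[ℂ] F) ⊗[ℂ] G) : ‖coeL₁₂ E F G z‖ = ‖z‖ :=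
  (norm_coeL _).trans (TensorProduct.norm_map (Completion.toComplₗᵢ (𝕜 := ℂ) (E := E ⊗[ℂ] F))
    (LinearIsometry.id (R := ℂ) (E := G)) z)

theorem norm_coeL₂₃ (z : E ⊗[ℂ] (F ⊗[ℂ] G)) : ‖coeL₂₃ E F G z‖ = ‖z‖ := by
  refine (norm_coeL _).trans ?_
  refine (congrArg norm (ContinuousLinearMap.lTensor_apply (coeL F G) z)).trans ?_
  exact TensorProduct.norm_map (LinearIsometry.id (R := ℂ) (E := E))
    (Completion.toComplₗᵢ (𝕜 := ℂ) (E := F ⊗[ℂ] G)) z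

theorem norm_assoc_aux (z : (E ⊗[ℂ] F) ⊗[ℂ] G) :
    ‖coeL₂₃ E F G ((TensorProduct.assocIsometry ℂ E F G).toLinearEquiv z)‖ =
      ‖coeL₁₂ E F G z‖ := by
  rw [norm_coeL₁₂, norm_coeL₂₃]
  exact (TensorProduct.assocIsometry ℂ E F G).norm_map z

theorem sum_tmul {ι : Type*} (s : Finset ι) (f : ι → E) (y : F) :
    tmul (∑ i ∈ s, f i) y = ∑ i ∈ s, tmul (f i) y := by
  simp only [tmul, TensorProduct.sum_tmul, map_sum]

theorem tmul_sum {ι : Type*} (s : Finset ι) (x : E) (f : ι → F) :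
    tmul x (∑ i ∈ s, f i) = ∑ i ∈ s, tmul x (f i) := by
  simp only [tmul, TensorProduct.tmul_sum, map_sum]

/-- The associator `(x ⊗ y) ⊗ z ↦ x ⊗ (y ⊗ z)`. -/
def assoc (E F G : Type*) [NormedAddCommGroup E] [InnerProductSpace ℂ E]
    [NormedAddCommGroup F] [InnerProductSpace ℂ F] [NormedAddCommGroup G] [InnerProductSpace ℂ G] :
    HilbertTensor (HilbertTensor E F) G ≃ₗᵢ[ℂ] HilbertTensor E (HilbertTensor F G) :=
  (TensorProduct.assocIsometry ℂ E F G).toLinearEquiv.extendOfIsometry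
    (coeL₁₂ E F G).toLinearMap (coeL₂₃ E F G).toLinearMap
    denseRange_coeL₁₂ denseRange_coeL₂₃ norm_assoc_aux

theorem assoc_tmul (x : E) (y : F) (z : G) :
    assoc E F G (tmul (tmul x y) z) = tmul x (tmul y z) :=
  LinearEquiv.extendOfIsometry_eq (f := (TensorProduct.assocIsometry ℂ E F G).toLinearEquiv)
    (e₁ := (coeL₁₂ E F G).toLinearMap)
    (e₂ := (coeL₂₃ E F G).toLinearMap)
    denseRange_coeL₁₂ denseRange_coeL₂₃ norm_assoc_aux ((x ⊗ₜ[ℂ] y) ⊗ₜ[ℂ] z)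

end HilbertTensor

end hilbert

/-! ### Unitary representations of `ℤ/Nℤ` and the braiding -/

/-- A unitary representation of `ℤ/Nℤ` on a Hilbert space. -/
structure ZNRep (N : ℕ) (L : Type*) [NormedAddCommGroup L] [InnerProductSpace ℂ L]
    [CompleteSpace L] where
  /-- The operators of the representation. -/
  π : ZMod N → (L →L[ℂ] L)
  π_zero : π 0 = 1
  π_add : ∀ s t, π (s + t) = π s * π t
  π_mem : ∀ t, π t ∈ unitary (L →L[ℂ] L)

namespace ZNRep

variable {N : ℕ} [NeZero N] {L K : Type*} [NormedAddCommGroup L] [InnerProductSpace ℂ L]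
  [CompleteSpace L] [NormedAddCommGroup K] [InnerProductSpace ℂ K] [CompleteSpace K]

theorem star_π (U : ZNRep N L) (t : ZMod N) : star (U.π t) = U.π (-t) := by
  have h1 : U.π t * U.π (-t) = 1 := by rw [← U.π_add, add_neg_cancel, U.π_zero]
  have h2 := (Unitary.mem_iff.mp (U.π_mem t)).1
  calc star (U.π t) = star (U.π t) * (U.π t * U.π (-t)) := by rw [h1, mul_one]
    _ = U.π (-t) := by rw [← mul_assoc, h2, one_mul]

/-- The tensor product representation. -/
def tensor (U : ZNRep N L) (V : ZNRep N K) : ZNRep N (HilbertTensor L K) where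
  π t := HilbertTensor.map (U.π t) (V.π t)
  π_zero := by rw [U.π_zero, V.π_zero, HilbertTensor.map_one_one]
  π_add s t := by rw [U.π_add, V.π_add, HilbertTensor.map_mul_map]
  π_mem t := by
    rw [Unitary.mem_iff, HilbertTensor.star_map, HilbertTensor.map_mul_map,
      HilbertTensor.map_mul_map, (Unitary.mem_iff.mp (U.π_mem t)).1,
      (Unitary.mem_iff.mp (V.π_mem t)).1, (Unitary.mem_iff.mp (U.π_mem t)).2,
      (Unitary.mem_iff.mp (V.π_mem t)).2, HilbertTensor.map_one_one]
    exact ⟨rfl, rfl⟩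

/-- The orthogonal projection onto the vectors `ξ` of degree `m`, those with
`U_t ξ = ω ^ (t m) ξ` for all `t`. -/
def proj (ω : ℂ) (U : ZNRep N L) (m : ZMod N) : L →L[ℂ] L :=
  (N : ℂ)⁻¹ • ∑ t : ZMod N, chi ω (-(t * m)) • U.π t

/-- The braiding unitary: on a vector `ξ` of degree `m` and a vector `η` of degree `n` it is
`ξ ⊗ η ↦ ω ^ (m n) η ⊗ ξ`, and `V_m η = ω ^ (m n) η`. -/
def braid (ω : ℂ) (U : ZNRep N L) (V : ZNRep N K) : HilbertTensor L K →L[ℂ] HilbertTensor K L :=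
  ∑ m : ZMod N, HilbertTensor.flip L K ∘L HilbertTensor.map (proj ω U m) (V.π m)

/-- The dual braiding unitary: on a vector `ξ` of degree `m` and a vector `η` of degree `n` it is
`η ⊗ ξ ↦ ω ^ (-m n) ξ ⊗ η`. -/
def dualBraid (ω : ℂ) (U : ZNRep N L) (V : ZNRep N K) :
    HilbertTensor K L →L[ℂ] HilbertTensor L K :=
  ∑ m : ZMod N, HilbertTensor.flip K L ∘L HilbertTensor.map (V.π (-m)) (proj ω U m)

variable {ω : ℂ}

theorem proj_apply_of_degree (hω : IsPrimitiveRoot ω N) (U : ZNRep N L) {ξ : L} {n : ZMod N}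
    (h : ∀ t, U.π t ξ = chi ω (t * n) • ξ) (m : ZMod N) :
    proj ω U m ξ = if m = n then ξ else 0 := by
  have hN : (N : ℂ) ≠ 0 := Nat.cast_ne_zero.mpr (NeZero.ne N)
  have h1 : proj ω U m ξ = ((N : ℂ)⁻¹ * ∑ t : ZMod N, chi ω (t * (n - m))) • ξ := by
    simp only [proj, smul_apply, sum_apply, h, smul_smul,
      ← chi_add hω, mul_smul, Finset.sum_smul]
    refine congrArg _ (Finset.sum_congr rfl fun t _ => ?_)
    congr 2
    ring
  rw [h1, sum_chi hω]
  by_cases hmn : m = n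
  · simp [hmn, hN]
  · simp [hmn, sub_eq_zero, Ne.symm hmn]

theorem degree_proj (hω : IsPrimitiveRoot ω N) (U : ZNRep N L) (ξ : L) (m t : ZMod N) :
    U.π t (proj ω U m ξ) = chi ω (t * m) • proj ω U m ξ := by
  simp only [proj, smul_apply, sum_apply, map_smul, map_sum]
  rw [smul_comm (chi ω (t * m))]
  refine congrArg (fun z : L => (N : ℂ)⁻¹ • z) ?_
  rw [Finset.smul_sum]
  refine Fintype.sum_equiv (Equiv.addLeft t) _ _ fun s => ?_
  rw [Equiv.coe_addLeft, U.π_add, smul_smul, ← chi_add hω, mul_apply_eq_comp]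
  congr 2
  ring

theorem sum_proj (hω : IsPrimitiveRoot ω N) (U : ZNRep N L) (ξ : L) :
    ∑ m, proj ω U m ξ = ξ := by
  have hN : (N : ℂ) ≠ 0 := Nat.cast_ne_zero.mpr (NeZero.ne N)
  simp only [proj, smul_apply, sum_apply]
  rw [← Finset.smul_sum, Finset.sum_comm]
  have h1 : ∀ t : ZMod N, ∑ m : ZMod N, chi ω (-(t * m)) • U.π t ξ =
      if t = 0 then (N : ℂ) • ξ else 0 := by
    intro t
    rw [← Finset.sum_smul]
    have h2 : ∑ m : ZMod N, chi ω (-(t * m)) = ∑ m : ZMod N, chi ω (m * (-t)) :=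
      Finset.sum_congr rfl fun m _ => by congr 1; ring
    rw [h2, sum_chi hω]
    by_cases ht : t = 0
    · simp [ht, U.π_zero]
    · simp [ht]
  rw [Finset.sum_congr rfl fun t _ => h1 t]
  simp [smul_smul, hN]

theorem star_proj (hω : IsPrimitiveRoot ω N) (U : ZNRep N L) (m : ZMod N) :
    star (proj ω U m) = proj ω U m := by
  simp only [proj, star_smul, star_sum, star_chi hω, star_π, star_inv₀, star_natCast]
  refine congrArg _ (Fintype.sum_equiv (Equiv.neg _) _ _ fun s => ?_)
  rw [Equiv.neg_apply]
  congr 2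
  ring

theorem braid_apply (U : ZNRep N L) (V : ZNRep N K) (ξ : L) (η : K) :
    braid ω U V (HilbertTensor.tmul ξ η) =
      ∑ m, HilbertTensor.tmul (V.π m η) (proj ω U m ξ) := by
  simp [braid]

theorem dualBraid_apply (U : ZNRep N L) (V : ZNRep N K) (ξ : L) (η : K) :
    dualBraid ω U V (HilbertTensor.tmul η ξ) =
      ∑ m, HilbertTensor.tmul (proj ω U m ξ) (V.π (-m) η) := by
  simp [dualBraid]

theorem braid_tmul (hω : IsPrimitiveRoot ω N) (U : ZNRep N L) (V : ZNRep N K) {ξ : L} {η : K}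
    {m n : ZMod N} (hξ : ∀ t, U.π t ξ = chi ω (t * m) • ξ)
    (hη : ∀ t, V.π t η = chi ω (t * n) • η) :
    braid ω U V (HilbertTensor.tmul ξ η) = chi ω (m * n) • HilbertTensor.tmul η ξ := by
  rw [braid_apply, Finset.sum_eq_single m, hη, proj_apply_of_degree hω U hξ, if_pos rfl,
    HilbertTensor.smul_tmul]
  · intro k _ hk
    rw [proj_apply_of_degree hω U hξ, if_neg hk, HilbertTensor.tmul_zero]
  · simp

theorem dualBraid_tmul (hω : IsPrimitiveRoot ω N) (U : ZNRep N L) (V : ZNRep N K) {ξ : L} {η : K}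
    {m n : ZMod N} (hξ : ∀ t, U.π t ξ = chi ω (t * m) • ξ)
    (hη : ∀ t, V.π t η = chi ω (t * n) • η) :
    dualBraid ω U V (HilbertTensor.tmul η ξ) = chi ω (-(m * n)) • HilbertTensor.tmul ξ η := by
  rw [dualBraid_apply, Finset.sum_eq_single m, hη, proj_apply_of_degree hω U hξ, if_pos rfl,
    HilbertTensor.tmul_smul, neg_mul]
  · intro k _ hk
    rw [proj_apply_of_degree hω U hξ, if_neg hk, HilbertTensor.zero_tmul]
  · simp

/-- Bounded operators on `L ⊗ K` that agree on tensors of homogeneous vectors are equal. -/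
theorem ext_degree (hω : IsPrimitiveRoot ω N) (U : ZNRep N L) (V : ZNRep N K)
    {X : Type*} [NormedAddCommGroup X] [NormedSpace ℂ X] {S T : HilbertTensor L K →L[ℂ] X}
    (h : ∀ (ξ : L) (η : K) (m n : ZMod N), (∀ t, U.π t ξ = chi ω (t * m) • ξ) →
      (∀ t, V.π t η = chi ω (t * n) • η) →
      S (HilbertTensor.tmul ξ η) = T (HilbertTensor.tmul ξ η)) : S = T := by
  refine HilbertTensor.ext_tmul fun x y => ?_
  rw [← sum_proj hω U x, ← sum_proj hω V y]
  simp only [HilbertTensor.sum_tmul, HilbertTensor.tmul_sum, map_sum]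
  exact Finset.sum_congr rfl fun m _ => Finset.sum_congr rfl fun n _ =>
    h _ _ _ _ (degree_proj hω U x _) (degree_proj hω V y _)

theorem dualBraid_comp_braid (hω : IsPrimitiveRoot ω N) (U : ZNRep N L) (V : ZNRep N K) :
    dualBraid ω U V ∘L braid ω U V = 1 := by
  refine ext_degree hω U V fun ξ η m n hξ hη => ?_
  rw [ContinuousLinearMap.comp_apply, braid_tmul hω U V hξ hη, map_smul,
    dualBraid_tmul hω U V hξ hη, smul_smul, ← chi_add hω, add_neg_cancel, chi_zero, one_smul,
    one_apply_eq_self]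

theorem braid_comp_dualBraid (hω : IsPrimitiveRoot ω N) (U : ZNRep N L) (V : ZNRep N K) :
    braid ω U V ∘L dualBraid ω U V = 1 := by
  refine ext_degree hω V U fun η ξ n m hη hξ => ?_
  rw [ContinuousLinearMap.comp_apply, dualBraid_tmul hω U V hξ hη, map_smul,
    braid_tmul hω U V hξ hη, smul_smul, ← chi_add hω, neg_add_cancel, chi_zero, one_smul,
    one_apply_eq_self]

theorem adjoint_braid (hω : IsPrimitiveRoot ω N) (U : ZNRep N L) (V : ZNRep N K) :
    ContinuousLinearMap.adjoint (braid ω U V) = dualBraid ω U V := by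
  refine HilbertTensor.adjoint_eq_of_tmul fun ξ η η' ξ' => ?_
  rw [braid_apply, dualBraid_apply, sum_inner, inner_sum]
  refine Finset.sum_congr rfl fun m _ => ?_
  have hP : inner ℂ (proj ω U m ξ) ξ' = inner ℂ ξ (proj ω U m ξ') := by
    conv_rhs => rw [← star_proj hω U m, ContinuousLinearMap.star_eq_adjoint,
      ContinuousLinearMap.adjoint_inner_right]
  have hV : inner ℂ (V.π m η) η' = inner ℂ η (V.π (-m) η') := by
    rw [← star_π, ContinuousLinearMap.star_eq_adjoint, ContinuousLinearMap.adjoint_inner_right]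
  rw [HilbertTensor.inner_tmul, HilbertTensor.inner_tmul, hP, hV, mul_comm]

theorem braid_comp_tensor (hω : IsPrimitiveRoot ω N) (U : ZNRep N L) (V : ZNRep N K) (t : ZMod N) :
    braid ω U V ∘L (U.tensor V).π t = (V.tensor U).π t ∘L braid ω U V := by
  refine ext_degree hω U V fun ξ η m n hξ hη => ?_
  simp only [ContinuousLinearMap.comp_apply, tensor, HilbertTensor.map_tmul, hξ, hη,
    HilbertTensor.smul_tmul, HilbertTensor.tmul_smul, map_smul, braid_tmul hω U V hξ hη,
    smul_smul]
  congr 1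
  ring

theorem tensor_comp_dualBraid (hω : IsPrimitiveRoot ω N) (U : ZNRep N L) (V : ZNRep N K)
    (t : ZMod N) :
    (U.tensor V).π t ∘L dualBraid ω U V = dualBraid ω U V ∘L (V.tensor U).π t := by
  refine ext_degree hω V U fun η ξ n m hη hξ => ?_
  simp only [ContinuousLinearMap.comp_apply, tensor, HilbertTensor.map_tmul, hξ, hη,
    HilbertTensor.smul_tmul, HilbertTensor.tmul_smul, map_smul, dualBraid_tmul hω U V hξ hη,
    smul_smul]
  congr 1
  ring

/-- The operator `x ⊗ id`. -/
def leg₁ (K : Type*) [NormedAddCommGroup K] [InnerProductSpace ℂ K]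
    (x : L →L[ℂ] L) : HilbertTensor L K →L[ℂ] HilbertTensor L K :=
  HilbertTensor.map x 1

/-- The operator `y ⊗ id` on `K ⊗ L`, conjugated by the braiding. -/
def leg₂ (ω : ℂ) (U : ZNRep N L) (V : ZNRep N K) (y : K →L[ℂ] K) :
    HilbertTensor L K →L[ℂ] HilbertTensor L K :=
  dualBraid ω U V ∘L HilbertTensor.map y 1 ∘L braid ω U V

/-- `x ↦ x ⊗ id` as a unital `*`-homomorphism. -/
def leg₁Hom (L K : Type*) [NormedAddCommGroup L] [InnerProductSpace ℂ L] [CompleteSpace L]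
    [NormedAddCommGroup K] [InnerProductSpace ℂ K] [CompleteSpace K] :
    (L →L[ℂ] L) →⋆ₐ[ℂ] (HilbertTensor L K →L[ℂ] HilbertTensor L K) where
  toFun x := leg₁ K x
  map_one' := HilbertTensor.map_one_one
  map_mul' x y := by rw [leg₁, leg₁, leg₁, HilbertTensor.map_mul_map, mul_one]
  map_zero' := HilbertTensor.ext_tmul fun x y => by simp [leg₁, HilbertTensor.zero_tmul]
  map_add' x y := HilbertTensor.ext_tmul fun x y => by simp [leg₁, HilbertTensor.add_tmul]
  commutes' c := HilbertTensor.ext_tmul fun x y => by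
    simp [leg₁, HilbertTensor.smul_tmul, Algebra.algebraMap_eq_smul_one]
  map_star' x := by rw [leg₁, leg₁, HilbertTensor.star_map, star_one]

theorem leg₂_eq (U : ZNRep N L) (V : ZNRep N K) (y : K →L[ℂ] K) :
    leg₂ ω U V y = dualBraid ω U V ∘L leg₁Hom K L y ∘L braid ω U V := rfl

/-- `y ↦ c (y ⊗ id) c*` as a unital `*`-homomorphism. -/
def leg₂Hom (hω : IsPrimitiveRoot ω N) (U : ZNRep N L) (V : ZNRep N K) :
    (K →L[ℂ] K) →⋆ₐ[ℂ] (HilbertTensor L K →L[ℂ] HilbertTensor L K) where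
  toFun y := leg₂ ω U V y
  map_one' := by
    rw [leg₂_eq, map_one, ContinuousLinearMap.one_def, ContinuousLinearMap.id_comp,
      dualBraid_comp_braid hω]
  map_mul' x y := by
    ext z
    have h := fun w => DFunLike.congr_fun (braid_comp_dualBraid hω U V) w
    simp only [ContinuousLinearMap.comp_apply, one_apply_eq_self] at h
    simp [leg₂_eq, h]
  map_zero' := by rw [leg₂_eq, _root_.map_zero]; simp
  map_add' x y := by
    rw [leg₂_eq, leg₂_eq, leg₂_eq, map_add, ContinuousLinearMap.add_comp,
      ContinuousLinearMap.comp_add]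
  commutes' c := by
    ext z
    have h := fun w => DFunLike.congr_fun (dualBraid_comp_braid hω U V) w
    simp only [ContinuousLinearMap.comp_apply, one_apply_eq_self] at h
    rw [leg₂_eq, AlgHomClass.commutes]
    simp [Algebra.algebraMap_eq_smul_one, h]
  map_star' x := by
    have h1 := adjoint_braid hω U V
    have h2 : ContinuousLinearMap.adjoint (dualBraid ω U V) = braid ω U V := by
      rw [← h1, ContinuousLinearMap.adjoint_adjoint]
    have h3 : ∀ T : HilbertTensor K L →L[ℂ] HilbertTensor K L,
        star (dualBraid ω U V ∘L T ∘L braid ω U V) = dualBraid ω U V ∘L star T ∘L braid ω U V := by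
      intro T
      rw [ContinuousLinearMap.star_eq_adjoint, ContinuousLinearMap.star_eq_adjoint,
        ContinuousLinearMap.adjoint_comp, ContinuousLinearMap.adjoint_comp, h1, h2,
        ContinuousLinearMap.comp_assoc]
    rw [leg₂_eq, leg₂_eq, h3, map_star]

/-- Conjugation by the representation. -/
def conj (U : ZNRep N L) (t : ZMod N) : (L →L[ℂ] L) →⋆ₐ[ℂ] (L →L[ℂ] L) :=
  (Unitary.conjStarAlgAut ℂ (L →L[ℂ] L) ⟨U.π t, U.π_mem t⟩).toStarAlgHom

theorem conj_apply (U : ZNRep N L) (t : ZMod N) (x : L →L[ℂ] L) :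
    U.conj t x = U.π t * x * star (U.π t) := rfl

theorem conj_leg₁ (U : ZNRep N L) (V : ZNRep N K) (t : ZMod N) (x : L →L[ℂ] L) :
    (U.tensor V).conj t (leg₁ K x) = leg₁ K (U.conj t x) := by
  have h : U.π t * x * star (U.π t) = U.π t * (x * star (U.π t)) := mul_assoc _ _ _
  rw [conj_apply, conj_apply, leg₁, leg₁, tensor, HilbertTensor.star_map,
    HilbertTensor.map_mul_map, HilbertTensor.map_mul_map, mul_one,
    (Unitary.mem_iff.mp (V.π_mem t)).2]

theorem conj_leg₂ (hω : IsPrimitiveRoot ω N) (U : ZNRep N L) (V : ZNRep N K) (t : ZMod N)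
    (y : K →L[ℂ] K) :
    (U.tensor V).conj t (leg₂ ω U V y) = leg₂ ω U V (V.conj t y) := by
  have hl := DFunLike.congr_fun (conj_leg₁ V U t y)
  have hb := DFunLike.congr_fun (braid_comp_tensor hω U V (-t))
  have hd := DFunLike.congr_fun (tensor_comp_dualBraid hω U V t)
  rw [conj_apply, star_π] at hl
  simp only [ContinuousLinearMap.comp_apply, mul_apply_eq_comp] at hl hb hd
  refine ContinuousLinearMap.ext fun z => ?_
  rw [conj_apply, star_π, leg₂, leg₂]
  simp only [ContinuousLinearMap.comp_apply, mul_apply_eq_comp]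
  rw [hb, hd]
  exact congrArg _ (hl _)

end ZNRep

/-! ### Braided tensor products -/

/-- A faithful equivariant representation of a `C*`-algebra with an action of `ℤ/Nℤ` on a Hilbert
space with a unitary representation of `ℤ/Nℤ`. -/
structure EquivRep {N : ℕ} [NeZero N] {X : Type*} [CStarAlgebra X] (α : ZNAction N X) (L : Type*)
    [NormedAddCommGroup L] [InnerProductSpace ℂ L] [CompleteSpace L] where
  /-- The unitary representation. -/
  U : ZNRep N L
  /-- The representation of the algebra. -/
  hom : X →⋆ₐ[ℂ] (L →L[ℂ] L)
  injective : Function.Injective hom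
  covariant : ∀ t x, hom (α.ρ x t) = U.π t * hom x * star (U.π t)

section braided

variable {N : ℕ} [NeZero N] {ω : ℂ} {X Y : Type*} [CStarAlgebra X] [CStarAlgebra Y]
  {α : ZNAction N X} {β : ZNAction N Y}
  {L K : Type*} [NormedAddCommGroup L] [InnerProductSpace ℂ L] [CompleteSpace L]
  [NormedAddCommGroup K] [InnerProductSpace ℂ K] [CompleteSpace K]

/-- The braided tensor product `X ⊠ Y`: the `C*`-algebra of operators on `L ⊗ K` generated by the
products `j₁(x) j₂(y)`. -/
def Braided (ω : ℂ) (θ : EquivRep α L) (κ : EquivRep β K) :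
    StarSubalgebra ℂ (HilbertTensor L K →L[ℂ] HilbertTensor L K) :=
  (StarAlgebra.adjoin ℂ {T | ∃ x y,
    T = ZNRep.leg₁ K (θ.hom x) * ZNRep.leg₂ ω θ.U κ.U (κ.hom y)}).topologicalClosure

namespace Braided

instance (θ : EquivRep α L) (κ : EquivRep β K) :
    IsClosed (Braided ω θ κ : Set (HilbertTensor L K →L[ℂ] HilbertTensor L K)) :=
  StarSubalgebra.isClosed_topologicalClosure _

theorem mul_mem (θ : EquivRep α L) (κ : EquivRep β K) (x : X) (y : Y) :
    ZNRep.leg₁ K (θ.hom x) * ZNRep.leg₂ ω θ.U κ.U (κ.hom y) ∈ Braided ω θ κ :=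
  StarSubalgebra.le_topologicalClosure _ (StarAlgebra.subset_adjoin ℂ _ ⟨x, y, rfl⟩)

/-- The embedding `j₁ : X → X ⊠ Y`. -/
def j₁ (hω : IsPrimitiveRoot ω N) (θ : EquivRep α L) (κ : EquivRep β K) :
    X →⋆ₐ[ℂ] Braided ω θ κ :=
  ((ZNRep.leg₁Hom L K).comp θ.hom).codRestrict _ fun x => by
    have := mul_mem (ω := ω) θ κ x 1
    have h1 : ZNRep.leg₂ ω θ.U κ.U (κ.hom 1) = 1 := by
      rw [map_one]; exact map_one (ZNRep.leg₂Hom hω θ.U κ.U)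
    rwa [h1, mul_one] at this

/-- The embedding `j₂ : Y → X ⊠ Y`. -/
def j₂ (hω : IsPrimitiveRoot ω N) (θ : EquivRep α L) (κ : EquivRep β K) :
    Y →⋆ₐ[ℂ] Braided ω θ κ :=
  ((ZNRep.leg₂Hom hω θ.U κ.U).comp κ.hom).codRestrict _ fun y => by
    have := mul_mem (ω := ω) θ κ 1 y
    have h1 : ZNRep.leg₁ K (θ.hom 1) = 1 := by
      rw [map_one]; exact map_one (ZNRep.leg₁Hom L K)
    rwa [h1, one_mul] at this

theorem conj_mem (hω : IsPrimitiveRoot ω N) (θ : EquivRep α L) (κ : EquivRep β K)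
    (t : ZMod N) {T : HilbertTensor L K →L[ℂ] HilbertTensor L K}
    (hT : T ∈ Braided ω θ κ) : (θ.U.tensor κ.U).conj t T ∈ Braided ω θ κ := by
  have hc : Continuous ((θ.U.tensor κ.U).conj t) := continuous_hom _
  have h1 : ∀ S ∈ StarAlgebra.adjoin ℂ {T | ∃ x y,
      T = ZNRep.leg₁ K (θ.hom x) * ZNRep.leg₂ ω θ.U κ.U (κ.hom y)},
      (θ.U.tensor κ.U).conj t S ∈ Braided ω θ κ := by
    intro S hS
    induction hS using StarAlgebra.adjoin_induction with
    | mem S hS =>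
      obtain ⟨x, y, rfl⟩ := hS
      have h2 := ZNRep.conj_leg₁ θ.U κ.U t (θ.hom x)
      have h3 := ZNRep.conj_leg₂ hω θ.U κ.U t (κ.hom y)
      rw [ZNRep.conj_apply θ.U, ← θ.covariant] at h2
      rw [ZNRep.conj_apply κ.U, ← κ.covariant] at h3
      rw [map_mul, h2, h3]
      exact mul_mem θ κ _ _
    | algebraMap c => rw [AlgHomClass.commutes]; exact algebraMap_mem _ c
    | add S T _ _ hS hT => rw [map_add]; exact add_mem hS hT
    | mul S T _ _ hS hT => rw [map_mul]; exact MulMemClass.mul_mem hS hT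
    | star S _ hS => rw [map_star]; exact star_mem hS
  have h4 := map_mem_closure hc hT h1
  have h5 : IsClosed (Braided ω θ κ : Set (HilbertTensor L K →L[ℂ] HilbertTensor L K)) :=
    inferInstance
  rwa [h5.closure_eq] at h4

/-- The coaction on `X ⊠ Y`, given by conjugation with the tensor product representation; it is the
coaction for which `j₁` and `j₂` are equivariant. -/
def action (hω : IsPrimitiveRoot ω N) (θ : EquivRep α L) (κ : EquivRep β K) :
    ZNAction N (Braided ω θ κ) :=
  ZNAction.ofFamily
    (fun t => (((θ.U.tensor κ.U).conj t).comp (Braided ω θ κ).subtype).codRestrict _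
      fun T => conj_mem hω θ κ t T.2)
    (fun T => by
      refine Subtype.ext ?_
      change (θ.U.tensor κ.U).conj 0 T.1 = T.1
      rw [ZNRep.conj_apply, ZNRep.π_zero, star_one, one_mul, mul_one])
    (fun s t T => by
      refine Subtype.ext ?_
      change (θ.U.tensor κ.U).conj s ((θ.U.tensor κ.U).conj t T.1) =
        (θ.U.tensor κ.U).conj (s + t) T.1
      rw [ZNRep.conj_apply, ZNRep.conj_apply, ZNRep.conj_apply, ZNRep.π_add, star_mul]
      simp only [mul_assoc])

theorem j₁_equivariant (hω : IsPrimitiveRoot ω N) (θ : EquivRep α L) (κ : EquivRep β K) :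
    ZNAction.IsEquivariant α (action hω θ κ) (j₁ hω θ κ) := by
  intro x t
  refine Subtype.ext ?_
  change (θ.U.tensor κ.U).conj t (ZNRep.leg₁ K (θ.hom x)) = ZNRep.leg₁ K (θ.hom (α.ρ x t))
  rw [ZNRep.conj_leg₁, ZNRep.conj_apply, θ.covariant]

theorem j₂_equivariant (hω : IsPrimitiveRoot ω N) (θ : EquivRep α L) (κ : EquivRep β K) :
    ZNAction.IsEquivariant β (action hω θ κ) (j₂ hω θ κ) := by
  intro y t
  refine Subtype.ext ?_
  change (θ.U.tensor κ.U).conj t (ZNRep.leg₂ ω θ.U κ.U (κ.hom y)) =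
    ZNRep.leg₂ ω θ.U κ.U (κ.hom (β.ρ y t))
  rw [ZNRep.conj_leg₂ hω, ZNRep.conj_apply, κ.covariant]

/-- The inclusion of `X ⊠ Y` into the bounded operators on `L ⊗ K` as a faithful equivariant
representation. -/
def rep (hω : IsPrimitiveRoot ω N) (θ : EquivRep α L) (κ : EquivRep β K) :
    EquivRep (action hω θ κ) (HilbertTensor L K) where
  U := θ.U.tensor κ.U
  hom := (Braided ω θ κ).subtype
  injective := Subtype.val_injective
  covariant _ _ := rfl

/-- The map `Φ : X ⊠ Y → X' ⊠ Y'` is the braided tensor product `φ ⊠ ψ` of the morphisms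
`φ : X → X'` and `ψ : Y → Y'`. -/
structure IsTensorMap (hω : IsPrimitiveRoot ω N) (θ : EquivRep α L) (κ : EquivRep β K)
    {X' Y' : Type*} [CStarAlgebra X'] [CStarAlgebra Y']
    {α' : ZNAction N X'} {β' : ZNAction N Y'}
    {L' K' : Type*} [NormedAddCommGroup L'] [InnerProductSpace ℂ L'] [CompleteSpace L']
    [NormedAddCommGroup K'] [InnerProductSpace ℂ K'] [CompleteSpace K']
    (θ' : EquivRep α' L') (κ' : EquivRep β' K') (φ : X →⋆ₐ[ℂ] X') (ψ : Y →⋆ₐ[ℂ] Y')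
    (Φ : Braided ω θ κ →⋆ₐ[ℂ] Braided ω θ' κ') : Prop where
  equivariant : ZNAction.IsEquivariant (action hω θ κ) (action hω θ' κ') Φ
  apply_mul : ∀ x y,
    Φ (j₁ hω θ κ x * j₂ hω θ κ y) = j₁ hω θ' κ' (φ x) * j₂ hω θ' κ' (ψ y)

end Braided

/-- `(X, α, Δ)` is an anyonic compact quantum group; the braided tensor products are formed with
the faithful equivariant representation `θ` of `X`. -/
structure IsAnyonicCQG (hω : IsPrimitiveRoot ω N) (θ : EquivRep α L)
    (Δ : X →⋆ₐ[ℂ] Braided ω θ θ) : Prop where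
  equivariant : ZNAction.IsEquivariant α (Braided.action hω θ θ) Δ
  /-- `(Δ ⊠ id) ∘ Δ = (id ⊠ Δ) ∘ Δ`, where `(X ⊠ X) ⊠ X` and `X ⊠ (X ⊠ X)` are identified by the
  associator of the Hilbert space `L`. -/
  coassoc : ∃ (Φ : Braided ω θ θ →⋆ₐ[ℂ] Braided ω (Braided.rep hω θ θ) θ)
    (Ψ : Braided ω θ θ →⋆ₐ[ℂ] Braided ω θ (Braided.rep hω θ θ)),
    Braided.IsTensorMap hω θ θ (Braided.rep hω θ θ) θ Δ (StarAlgHom.id ℂ X) Φ ∧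
    Braided.IsTensorMap hω θ θ θ (Braided.rep hω θ θ) (StarAlgHom.id ℂ X) Δ Ψ ∧
    ∀ x ξ, HilbertTensor.assoc L L L ((Φ (Δ x)).1 ξ) =
      (Ψ (Δ x)).1 (HilbertTensor.assoc L L L ξ)
  /-- `Δ(X) (1 ⊠ X) = X ⊠ X`. -/
  bisimplifiable_right : (Submodule.span ℂ {T | ∃ x y,
    T = Δ x * Braided.j₂ hω θ θ y}).topologicalClosure = ⊤
  /-- `Δ(X) (X ⊠ 1) = X ⊠ X`. -/
  bisimplifiable_left : (Submodule.span ℂ {T | ∃ x y,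
    T = Δ x * Braided.j₁ hω θ θ y}).topologicalClosure = ⊤

end braided

end

/-! Everything rests on one commutation rule. If y has degree n, then j₂(y) is the operator π(-n) ⊗
y, so the two legs of a braided tensor product commute up to the action: j₂(y) j₁(x) = j₁(x)
j₂(ρ_{-m}(y)) for x of degree m (`Braided.j₂_mul_j₁`). For homogeneous y this is the scalar ω^(-mn),
and by Fourier analysis on ℤ/Nℤ every element is a finite sum of homogeneous ones.

Comultiplication. Let u₁ and u₂ be the images of u under j₁ and j₂. The prescribed matrix is u₁u₂, a
product of unitaries. Its entrywise adjoint has the legs in the wrong order; restoring the order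
costs a power of ω, which the weights ω^(-i(j-i)) absorb exactly. Hence the twisted conjugate of
u₁u₂ is the product of the two copies of the twisted conjugate of u
(`FreeUnitary.twistedConj_comulMatrix`), again unitary, and the universal property yields Δ.
Uniqueness, equivariance and coassociativity are then checked on generators.

Coassociativity first requires the maps Δ ⊠ id and id ⊠ Δ. The braided tensor product is an algebra
of operators, so well-definedness is the issue. It is settled by slicing: each product j₁(x) j₂(y)
is a finite sum of elementary tensors of operators, either directly or after conjugation by the
braiding, and its slices lie in the represented algebra on which the given morphism is defined. An
element all of whose slices vanish is zero, so the closed graph is single valued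
(`HilbertTensor.exists_starAlgHom_of_slice`).

Bisimplifiability. Unitarity solves Δ(u) = u₁u₂ for either leg, and likewise for the twisted
conjugate. So the closed span in question contains one leg of all generators and of their adjoints;
the commutation rule extends this to products.

A faithful equivariant representation is obtained by inducing a faithful sum of GNS representations
from the trivial group to ℤ/Nℤ (`exists_equivRep`). -/

noncomputable section

open scoped TensorProduct InnerProductSpace

set_option linter.unusedSectionVars false

/-! ### Faithful equivariant representations -/

section representations

open scoped ComplexOrder

/-- Positive functionals separate the positive elements of a `C*`-algebra from zero. -/
theorem exists_positiveLinearMap_ne_zero {A : Type*} [CStarAlgebra A] [PartialOrder A]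
    [StarOrderedRing A] {a : A} (ha : 0 ≤ a) (h0 : a ≠ 0) : ∃ f : A →ₚ[ℂ] ℂ, f a ≠ 0 := by
  have hna : -a ∉ ProperCone.positive ℝ A := fun h =>
    h0 (le_antisymm (neg_nonneg.mp (ProperCone.mem_positive.mp h)) ha)
  obtain ⟨f, hf, hfa⟩ := ProperCone.hyperplane_separation_point _ hna
  -- The separating functional is only real linear on all of `A`. Precomposing with the real part
  -- makes it vanish on skew-adjoint elements, so that its complex linear extension still agrees
  -- with `f` on self-adjoint ones.
  let g : Module.Dual ℝ A := f.toLinearMap ∘ₗ (selfAdjoint.submodule ℝ A).subtype ∘ₗ realPart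
  have hg : ∀ x : A, IsSelfAdjoint x → g x = f x := fun x hx => by
    change f (realPart x : A) = f x
    rw [hx.coe_realPart]
  have hG : ∀ x : A, IsSelfAdjoint x → (g.extendRCLike : Module.Dual ℂ A) x = (f x : ℂ) := by
    intro x hx
    have h1 : g (Complex.I • x) = 0 := by
      change f (realPart (Complex.I • x) : A) = 0
      simp [realPart_I_smul, hx.imaginaryPart]
    rw [Module.Dual.extendRCLike_apply, hg x hx]
    erw [h1]
    simp
  refine ⟨PositiveLinearMap.mk₀ g.extendRCLike fun x hx => ?_, ?_⟩
  · rw [hG x (.of_nonneg hx)]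
    exact Complex.zero_le_real.mpr (hf x (ProperCone.mem_positive.mpr hx))
  · change (g.extendRCLike : Module.Dual ℂ A) a ≠ 0
    rw [hG a (.of_nonneg ha)]
    rw [map_neg, neg_lt_zero] at hfa
    exact_mod_cast hfa.ne'

/-- The `GNS` representation does not vanish where the functional does not vanish. -/
theorem gnsStarAlgHom_ne_zero {A : Type*} [CStarAlgebra A] [PartialOrder A]
    [StarOrderedRing A] (f : A →ₚ[ℂ] ℂ) {b : A} (hb : f (star b * b) ≠ 0) :
    f.gnsStarAlgHom b ≠ 0 := by
  intro h
  -- Test on the cyclic vector: the class of 1 goes to the class of `b`, whose squared norm is f(b*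
  -- b).
  have h1 : f.gnsNonUnitalStarAlgHom b (f.toPreGNS 1) = 0 := by
    have : f.gnsStarAlgHom b (f.toPreGNS 1 : f.GNS) = 0 := by rw [h]; rfl
    exact this
  rw [PositiveLinearMap.gnsNonUnitalStarAlgHom_apply_coe] at h1
  have h2 : ‖f.leftMulMapPreGNS b (f.toPreGNS 1)‖ = 0 := by
    rw [← UniformSpace.Completion.norm_coe, h1, norm_zero]
  have h3 := f.preGNS_norm_sq (f.leftMulMapPreGNS b (f.toPreGNS 1))
  rw [h2] at h3
  apply hb
  simpa using h3.symm

/-! ### Hilbert sums of representations -/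

variable {ι : Type*} {G : ι → Type*} [∀ i, NormedAddCommGroup (G i)]
  [∀ i, InnerProductSpace ℂ (G i)] [∀ i, CompleteSpace (G i)]

/-- A uniformly bounded family of operators preserves square summability. -/
theorem memℓp_two_of_norm_le {f : ∀ i, G i} (hf : Memℓp f 2) {g : ∀ i, G i} {C : ℝ}
    (h : ∀ i, ‖g i‖ ≤ C * ‖f i‖) : Memℓp g 2 := by
  rw [memℓp_gen_iff (by norm_num)] at hf ⊢
  simp only [ENNReal.toReal_ofNat, Real.rpow_ofNat] at hf ⊢
  refine Summable.of_nonneg_of_le (fun i => by positivity) (fun i => ?_) (hf.mul_left (C ^ 2))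
  rw [← mul_pow]
  exact pow_le_pow_left₀ (norm_nonneg _) (h i) 2

theorem lp_two_norm_le {f g : lp G 2} {C : ℝ} (hC : 0 ≤ C)
    (h : ∀ i, ‖g i‖ ≤ C * ‖f i‖) : ‖g‖ ≤ C * ‖f‖ := by
  refine lp.norm_le_of_forall_sum_le (by norm_num) (by positivity) fun s => ?_
  simp only [ENNReal.toReal_ofNat, Real.rpow_ofNat]
  calc ∑ i ∈ s, ‖g i‖ ^ 2 ≤ ∑ i ∈ s, C ^ 2 * ‖f i‖ ^ 2 := by
        refine Finset.sum_le_sum fun i _ => ?_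
        rw [← mul_pow]
        exact pow_le_pow_left₀ (norm_nonneg _) (h i) 2
    _ = C ^ 2 * ∑ i ∈ s, ‖f i‖ ^ 2 := by rw [Finset.mul_sum]
    _ ≤ C ^ 2 * ‖f‖ ^ 2 := by
        gcongr
        have := lp.sum_rpow_le_norm_rpow (p := 2) (by norm_num) f s
        simpa using this
    _ = _ := by rw [mul_pow]

/-- The block diagonal operator on a Hilbert sum with uniformly bounded blocks. -/
def lpDiagonal (T : ∀ i, G i →L[ℂ] G i) (C : ℝ) (hC : 0 ≤ C) (hT : ∀ i, ‖T i‖ ≤ C) :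
    lp G 2 →L[ℂ] lp G 2 :=
  LinearMap.mkContinuous
    { toFun := fun f => ⟨fun i => T i (f i), memℓp_two_of_norm_le (lp.memℓp f)
        fun i => (T i).le_of_opNorm_le (hT i) _⟩
      map_add' := fun f g => by ext i; exact map_add (T i) _ _
      map_smul' := fun c f => by ext i; simp } C
    fun f => lp_two_norm_le hC fun i => (T i).le_of_opNorm_le (hT i) _

/-- The direct sum of a family of representations. -/
def lpSumHom {X : Type*} [CStarAlgebra X] (σ : ∀ i, X →⋆ₐ[ℂ] (G i →L[ℂ] G i)) :
    X →⋆ₐ[ℂ] (lp G 2 →L[ℂ] lp G 2) where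
  -- The norm of `x` bounds all blocks at once because `*`-homomorphisms are contractive.
  toFun x := lpDiagonal (fun i => σ i x) ‖x‖ (norm_nonneg x)
    fun i => NonUnitalStarAlgHom.norm_apply_le (σ i) x
  map_one' := by ext f i; simp [lpDiagonal]
  map_mul' x y := by ext f i; simp [lpDiagonal]
  map_zero' := by ext f i; simp [lpDiagonal]
  map_add' x y := by
    ext f i
    exact DFunLike.congr_fun (map_add (σ i) x y) (f i)
  commutes' c := by ext f i; simp [lpDiagonal, Algebra.algebraMap_eq_smul_one]
  map_star' x := by
    refine (ContinuousLinearMap.eq_adjoint_iff _ _).mpr fun f g => ?_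
    rw [lp.inner_eq_tsum, lp.inner_eq_tsum]
    refine tsum_congr fun i => ?_
    change inner ℂ (σ i (star x) (f i)) (g i) = inner ℂ (f i) (σ i x (g i))
    rw [map_star, ContinuousLinearMap.star_eq_adjoint, ContinuousLinearMap.adjoint_inner_left]

end representations

/-- The automorphism by which an element of `ℤ/Nℤ` acts. -/
def ZNAction.at {N : ℕ} [NeZero N] {X : Type*} [CStarAlgebra X] (α : ZNAction N X) (t : ZMod N) :
    X →⋆ₐ[ℂ] X :=
  (Pi.evalStarAlgHom ℂ (fun _ : ZMod N => X) t).comp α.ρ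

theorem ZNAction.at_apply {N : ℕ} [NeZero N] {X : Type*} [CStarAlgebra X] (α : ZNAction N X)
    (t : ZMod N) (x : X) : α.at t x = α.ρ x t := rfl

/-! ### Translations on Hilbert sums indexed by ι × ℤ/Nℤ -/

section shift

variable {N : ℕ} [NeZero N] {ι : Type*} {H : ι → Type*} [∀ i, NormedAddCommGroup (H i)]
  [∀ i, InnerProductSpace ℂ (H i)] [∀ i, CompleteSpace (H i)]

/-- The translation of the coordinates of a Hilbert sum over `ι × ℤ/Nℤ`. -/
def lpShift (t : ZMod N) :
    lp (fun p : ι × ZMod N => H p.1) 2 →L[ℂ] lp (fun p : ι × ZMod N => H p.1) 2 :=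
  LinearMap.mkContinuous
    { toFun := fun f => ⟨fun p => f (p.1, p.2 + t), by
        have hf := lp.memℓp f
        change Memℓp (fun p : ι × ZMod N => f (p.1, p.2 + t)) 2
        rw [memℓp_gen_iff (by norm_num)] at hf ⊢
        exact ((Equiv.refl ι).prodCongr (Equiv.addRight t)).summable_iff.mpr hf⟩
      map_add' := fun f g => rfl
      map_smul' := fun c f => rfl } 1
    fun f => by
      refine le_of_eq ?_
      rw [one_mul, lp.norm_eq_tsum_rpow (by norm_num), lp.norm_eq_tsum_rpow (by norm_num)]
      congr 1
      exact ((Equiv.refl ι).prodCongr (Equiv.addRight t)).tsum_eq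
        (fun p : ι × ZMod N => ‖f p‖ ^ (2 : ENNReal).toReal)

theorem star_lpShift (t : ZMod N) :
    star (lpShift t : lp (fun p : ι × ZMod N => H p.1) 2 →L[ℂ] _) = lpShift (-t) := by
  refine ((ContinuousLinearMap.eq_adjoint_iff _ _).mpr fun f g => ?_).symm
  rw [lp.inner_eq_tsum, lp.inner_eq_tsum]
  refine (((Equiv.refl ι).prodCongr (Equiv.addRight t)).tsum_eq _).symm.trans ?_
  refine tsum_congr fun p => ?_
  change inner ℂ (f (p.1, p.2 + t + -t)) (g (p.1, p.2 + t)) = inner ℂ (f p) (g (p.1, p.2 + t))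
  rw [add_neg_cancel_right]

/-- The representation of `ℤ/Nℤ` by translations of the coordinates. -/
def lpShiftRep (N : ℕ) [NeZero N] {ι : Type*} (H : ι → Type*) [∀ i, NormedAddCommGroup (H i)]
    [∀ i, InnerProductSpace ℂ (H i)] [∀ i, CompleteSpace (H i)] :
    ZNRep N (lp (fun p : ι × ZMod N => H p.1) 2) where
  π := lpShift
  π_zero := by
    ext f p
    change f (p.1, p.2 + 0) = f p
    rw [add_zero]
  π_add s t := by
    ext f p
    change f (p.1, p.2 + (s + t)) = f (p.1, p.2 + s + t)
    rw [add_assoc]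
  π_mem t := by
    rw [Unitary.mem_iff, star_lpShift]
    constructor <;> ext f p
    · change f (p.1, p.2 + -t + t) = f p
      rw [neg_add_cancel_right]
    · change f (p.1, p.2 + t + -t) = f p
      rw [add_neg_cancel_right]

end shift

open scoped ComplexOrder in
/-- Every action of `ℤ/Nℤ` on a `C*`-algebra has a faithful equivariant representation. -/
theorem exists_equivRep {N : ℕ} [NeZero N] {X : Type} [CStarAlgebra X] (α : ZNAction N X)
    (h0 : ∀ x, α.ρ x 0 = x) :
    ∃ (L : Type) (_ : NormedAddCommGroup L) (_ : InnerProductSpace ℂ L) (_ : CompleteSpace L),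
      Nonempty (EquivRep α L) := by
  let _ := CStarAlgebra.spectralOrder X
  have _ := CStarAlgebra.spectralOrderedRing X
  have hf : ∀ b : {b : X // b ≠ 0}, ∃ f : X →ₚ[ℂ] ℂ, f (star b.1 * b.1) ≠ 0 := fun b =>
    exists_positiveLinearMap_ne_zero (star_mul_self_nonneg b.1)
      fun h => b.2 (CStarRing.star_mul_self_eq_zero_iff b.1 |>.mp h)
  choose f hf using hf
  -- Induced representation: the coordinate (b, s) carries the GNS representation of `f b` twisted
  -- by ρ_s, so translating the second index implements the action.
  let σ := fun p : {b : X // b ≠ 0} × ZMod N => (f p.1).gnsStarAlgHom.comp (α.at p.2)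
  refine ⟨lp (fun p : {b : X // b ≠ 0} × ZMod N => (f p.1).GNS) 2, inferInstance, inferInstance,
    inferInstance, ⟨⟨lpShiftRep N (fun b => (f b).GNS), lpSumHom σ, ?_, fun t x => ?_⟩⟩⟩
  · classical
    refine (injective_iff_map_eq_zero _).mpr fun b hb => ?_
    by_contra hne
    -- A nonzero `b` is detected by its own functional, in the coordinate where the twist is trivial
    -- by `h0`.
    let q : {b : X // b ≠ 0} × ZMod N := (⟨b, hne⟩, 0)
    refine gnsStarAlgHom_ne_zero (f q.1) (hf q.1) (ContinuousLinearMap.ext fun v => ?_)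
    have h1 := congrArg (fun g : lp (fun p : {b : X // b ≠ 0} × ZMod N => (f p.1).GNS) 2 => g q)
      (DFunLike.congr_fun hb
        (lp.single (E := fun p : {b : X // b ≠ 0} × ZMod N => (f p.1).GNS) 2 q v))
    change (f q.1).gnsStarAlgHom (α.ρ b 0) (lp.single
      (E := fun p : {b : X // b ≠ 0} × ZMod N => (f p.1).GNS) 2 q v q) = 0 at h1
    rw [lp.single_apply_self, h0] at h1
    exact h1
  · ext v p
    rw [ZNRep.star_π]
    change (f p.1).gnsStarAlgHom (α.ρ (α.ρ x t) p.2) (v p) =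
      (f p.1).gnsStarAlgHom (α.ρ x (p.2 + t)) (v (p.1, p.2 + t + -t))
    -- Both sides apply ρ_{p+t}(x) to the same coordinate of `v`.
    rw [α.coassoc, add_neg_cancel_right]

/-! ### Homomorphisms defined on generators -/

section generators

/-- If the span of a set is closed under products and adjoints of the elements of the set, then it
contains the `*`-algebra generated by the set. -/
theorem adjoin_subset_span {B : Type*} [Ring B] [StarRing B] [Algebra ℂ B] [StarModule ℂ B]
    {S : Set B} (h1 : 1 ∈ Submodule.span ℂ S)
    (hm : ∀ s ∈ S, ∀ t ∈ S, s * t ∈ Submodule.span ℂ S)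
    (hs : ∀ s ∈ S, star s ∈ Submodule.span ℂ S) {z : B} (hz : z ∈ StarAlgebra.adjoin ℂ S) :
    z ∈ Submodule.span ℂ S := by
  induction hz using StarAlgebra.adjoin_induction with
  | mem s hs => exact Submodule.subset_span hs
  | algebraMap c =>
    rw [Algebra.algebraMap_eq_smul_one]
    exact Submodule.smul_mem _ c h1
  | add s t _ _ hs ht => exact add_mem hs ht
  | mul s t hs₀ ht₀ ihs iht =>
    clear hs₀ ht₀
    induction ihs using Submodule.span_induction with
    | mem s hs =>
      induction iht using Submodule.span_induction with
      | mem t ht => exact hm s hs t ht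
      | zero => rw [mul_zero]; exact zero_mem _
      | add t t' _ _ h h' => rw [mul_add]; exact add_mem h h'
      | smul c t _ h => rw [mul_smul_comm]; exact Submodule.smul_mem _ c h
    | zero => rw [zero_mul]; exact zero_mem _
    | add s s' _ _ h h' => rw [add_mul]; exact add_mem h h'
    | smul c s _ h => rw [smul_mul_assoc]; exact Submodule.smul_mem _ c h
  | star s hs₀ ih =>
    clear hs₀
    induction ih using Submodule.span_induction with
    | mem s h => exact hs s h
    | zero => rw [star_zero]; exact zero_mem _
    | add s s' _ _ h h' => rw [star_add]; exact add_mem h h'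
    | smul c s _ h => rw [star_smul]; exact Submodule.smul_mem _ _ h

/-- A closed `*`-subalgebra of `P × Q` that is the graph of a function on a generating set of `P` is
the graph of a unital `*`-homomorphism. -/
theorem exists_starAlgHom_of_graph {P Q : Type*} [CStarAlgebra P] [CStarAlgebra Q]
    {S : Set (P × Q)}
    (hd : (StarAlgebra.adjoin ℂ (Prod.fst '' S)).topologicalClosure = ⊤)
    (hinj : ∀ z ∈ (StarAlgebra.adjoin ℂ S).topologicalClosure, z.1 = 0 → z.2 = 0) :
    ∃ Φ : P →⋆ₐ[ℂ] Q, ∀ z ∈ S, Φ z.1 = z.2 := by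
  have hcl : IsClosed ((StarAlgebra.adjoin ℂ S).topologicalClosure : Set (P × Q)) :=
    StarSubalgebra.isClosed_topologicalClosure _
  set 𝒢 := (StarAlgebra.adjoin ℂ S).topologicalClosure
  let p : 𝒢 →⋆ₐ[ℂ] P := (StarAlgHom.fst ℂ P Q).comp 𝒢.subtype
  -- Single-valuedness of the graph is injectivity of the first projection. An injective
  -- `*`-homomorphism is isometric, so its range is closed; containing a generating set, it is all
  -- of `P`.
  have hp : Function.Injective p := (injective_iff_map_eq_zero p).mpr fun z hz =>
    Subtype.ext (Prod.ext hz (hinj z.1 z.2 hz))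
  have hr : IsClosed (p.range : Set P) := by
    exact (NonUnitalStarAlgHom.isometry p hp).isClosedEmbedding.isClosed_range
  have hsurj : Function.Surjective p := by
    have hle : (StarAlgebra.adjoin ℂ (Prod.fst '' S)).topologicalClosure ≤ p.range := by
      refine StarSubalgebra.topologicalClosure_minimal (StarAlgebra.adjoin_le ?_) hr
      rintro _ ⟨z, hz, rfl⟩
      exact ⟨⟨z, StarSubalgebra.le_topologicalClosure _ (StarAlgebra.subset_adjoin ℂ _ hz)⟩, rfl⟩
    rw [hd] at hle
    intro x
    exact hle (Set.mem_univ x)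
  let e := StarAlgEquiv.ofBijective p ⟨hp, hsurj⟩
  refine ⟨((StarAlgHom.snd ℂ P Q).comp 𝒢.subtype).comp e.symm.toStarAlgHom, fun z hz => ?_⟩
  let w : 𝒢 := ⟨z, StarSubalgebra.le_topologicalClosure _ (StarAlgebra.subset_adjoin ℂ _ hz)⟩
  have hw : e.symm z.1 = w := e.symm_apply_eq.mpr rfl
  change (e.symm z.1).1.2 = z.2
  rw [hw]

/-- Unital `*`-homomorphisms on a `C*`-algebra that agree on a generating set are equal. -/
theorem starAlgHom_ext_of_adjoin {P Q : Type*} [CStarAlgebra P] [CStarAlgebra Q] {S : Set P}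
    (hd : (StarAlgebra.adjoin ℂ S).topologicalClosure = ⊤) {f g : P →⋆ₐ[ℂ] Q}
    (h : ∀ s ∈ S, f s = g s) : f = g := by
  have hcl : IsClosed (StarAlgHom.equalizer f g : Set P) :=
    isClosed_eq (continuous_hom f) (continuous_hom g)
  have hle : (StarAlgebra.adjoin ℂ S).topologicalClosure ≤ StarAlgHom.equalizer f g :=
    StarSubalgebra.topologicalClosure_minimal (StarAlgebra.adjoin_le h) hcl
  rw [hd] at hle
  ext x
  exact hle (Set.mem_univ x)

end generators

/-! ### Slices -/

namespace HilbertTensor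

variable {E F F' : Type*} [NormedAddCommGroup E] [InnerProductSpace ℂ E]
  [NormedAddCommGroup F] [InnerProductSpace ℂ F] [CompleteSpace F]
  [NormedAddCommGroup F'] [InnerProductSpace ℂ F'] [CompleteSpace F']

/-- The operator `y ↦ x ⊗ y`. -/
def tmulCLM (x : E) : F →L[ℂ] HilbertTensor E F := coeL E F ∘L TensorProduct.mkL ℂ E F x

/-- The slice of an operator by the functional `⟪e, · f⟫` on the first tensor factor. -/
def slice (e f : E) :
    (HilbertTensor E F →L[ℂ] HilbertTensor E F) →L[ℂ] (F →L[ℂ] F) :=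
  (ContinuousLinearMap.compL ℂ F (HilbertTensor E F) F (ContinuousLinearMap.adjoint (tmulCLM e))) ∘L
    (ContinuousLinearMap.compL ℂ F (HilbertTensor E F) (HilbertTensor E F)).flip (tmulCLM f)

theorem slice_apply (e f : E) (T : HilbertTensor E F →L[ℂ] HilbertTensor E F) :
    slice e f T = ContinuousLinearMap.adjoint (tmulCLM e) ∘L T ∘L tmulCLM f := rfl

theorem inner_slice (e f : E) (T : HilbertTensor E F →L[ℂ] HilbertTensor E F) (x y : F) :
    inner ℂ x (slice e f T y) = inner ℂ (tmul e x) (T (tmul f y)) := by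
  rw [slice_apply, ContinuousLinearMap.comp_apply, ContinuousLinearMap.adjoint_inner_right]
  rfl

/-- This is how slices recover an element of the second algebra: on an elementary tensor of
operators only a scalar is left of the first factor. -/
theorem slice_map (e f : E) (S : E →L[ℂ] E) (T : F →L[ℂ] F) :
    slice e f (map S T) = inner ℂ e (S f) • T := by
  ext y
  refine ext_inner_left ℂ fun x => ?_
  rw [inner_slice, map_tmul, inner_tmul, smul_apply, inner_smul_right]

/-- The slices contain all matrix coefficients between elementary tensors, and these determine the
operator. -/
theorem eq_zero_of_slice {T : HilbertTensor E F →L[ℂ] HilbertTensor E F}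
    (h : ∀ e f, slice e f T = 0) : T = 0 := by
  have h1 : ContinuousLinearMap.adjoint T = 0 := by
    refine adjoint_eq_of_tmul fun x y x' y' => ?_
    rw [zero_apply, inner_zero_right, ← inner_conj_symm, ← inner_slice, h]
    simp
  exact (map_eq_zero_iff _ ContinuousLinearMap.adjoint.injective).mp h1

/-- Extension of a map between operator algebras on Hilbert tensor products that is covered by a
map between the slices. -/
theorem exists_starAlgHom_of_slice {P Q X : Type*} [CStarAlgebra P] [CStarAlgebra Q]
    [CStarAlgebra X] (A : P →L[ℂ] (HilbertTensor E F →L[ℂ] HilbertTensor E F))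
    (A' : Q →L[ℂ] (HilbertTensor E F' →L[ℂ] HilbertTensor E F')) (hA' : Function.Injective A')
    (θ : X →⋆ₐ[ℂ] (F →L[ℂ] F)) (hθ : Function.Injective θ) (θ' : X →⋆ₐ[ℂ] (F' →L[ℂ] F'))
    {S : Set (P × Q)} (hd : (StarAlgebra.adjoin ℂ (Prod.fst '' S)).topologicalClosure = ⊤)
    (hS : ∀ z ∈ StarAlgebra.adjoin ℂ S, z ∈ Submodule.span ℂ S)
    (hsl : ∀ z ∈ S, ∀ e f, ∃ x, θ x = slice e f (A z.1) ∧ θ' x = slice e f (A' z.2)) :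
    ∃ Φ : P →⋆ₐ[ℂ] Q, ∀ z ∈ S, Φ z.1 = z.2 := by
  refine exists_starAlgHom_of_graph hd fun z hz hz0 => ?_
  -- The range of `Θ` is the graph relation between the two representations of `X`. It is closed
  -- because `θ` is injective, which makes `Θ` isometric; this lets the relation between slices pass
  -- from the span of `S` to its closure.
  let Θ : X →⋆ₐ[ℂ] (F →L[ℂ] F) × (F' →L[ℂ] F') := θ.prod θ'
  have hΘ : Function.Injective Θ := fun x y hxy => hθ (congrArg Prod.fst hxy)
  have hcl : IsClosed (Set.range Θ) :=
    (NonUnitalStarAlgHom.isometry Θ hΘ).isClosedEmbedding.isClosed_range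
  have key : ∀ e f, ∃ x, θ x = slice e f (A z.1) ∧ θ' x = slice e f (A' z.2) := by
    intro e f
    let D : P × Q →L[ℂ] (F →L[ℂ] F) × (F' →L[ℂ] F') :=
      ContinuousLinearMap.prodMap (slice e f ∘L A) (slice e f ∘L A')
    let W : Submodule ℂ (P × Q) := (LinearMap.range Θ.toAlgHom.toLinearMap).comap D.toLinearMap
    have hW : IsClosed (W : Set (P × Q)) := hcl.preimage D.continuous
    have hSW : Submodule.span ℂ S ≤ W := Submodule.span_le.mpr fun s hs => by
      obtain ⟨x, hx, hx'⟩ := hsl s hs e f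
      exact ⟨x, Prod.ext hx hx'⟩
    have hzW : z ∈ W :=
      closure_minimal (fun s hs => hSW (hS s hs) : (StarAlgebra.adjoin ℂ S : Set _) ⊆ W) hW hz
    obtain ⟨x, hx⟩ := hzW
    exact ⟨x, congrArg Prod.fst hx, congrArg Prod.snd hx⟩
  -- If the first component is zero, then the common element `x` behind each pair of slices is
  -- killed by `θ`, hence is zero, and so all slices of the second component vanish.
  refine (map_eq_zero_iff A' hA').mp (eq_zero_of_slice fun e f => ?_)
  obtain ⟨x, hx, hx'⟩ := key e f
  rw [hz0, _root_.map_zero, _root_.map_zero] at hx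
  rw [← hx', (map_eq_zero_iff θ hθ).mp hx, _root_.map_zero]

end HilbertTensor

/-! ### Homogeneous operators and the braiding -/

namespace ZNRep

variable {N : ℕ} [NeZero N] {ω : ℂ} {L K : Type*} [NormedAddCommGroup L] [InnerProductSpace ℂ L]
  [CompleteSpace L] [NormedAddCommGroup K] [InnerProductSpace ℂ K] [CompleteSpace K]

/-- Degrees add: an operator of degree m shifts the degree of vectors by m. -/
theorem π_apply_of_degree (hω : IsPrimitiveRoot ω N) (U : ZNRep N L) {x : L →L[ℂ] L} {m : ZMod N}
    (hx : ∀ t, U.conj t x = chi ω (t * m) • x) {ξ : L} {a : ZMod N}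
    (hξ : ∀ t, U.π t ξ = chi ω (t * a) • ξ) (t : ZMod N) :
    U.π t (x ξ) = chi ω (t * (m + a)) • x ξ := by
  have h1 : U.conj t x (U.π t ξ) = U.π t (x ξ) := by
    rw [conj_apply, star_π, mul_apply_eq_comp, mul_apply_eq_comp, ← mul_apply_eq_comp (U.π (-t)),
      ← U.π_add, neg_add_cancel, U.π_zero, one_apply_eq_self]
  rw [← h1, hx, hξ, map_smul, smul_apply, smul_smul, ← chi_add hω]
  congr 2
  ring

/-- The second leg of a homogeneous operator. -/
theorem leg₂_of_degree (hω : IsPrimitiveRoot ω N) (U : ZNRep N L) (V : ZNRep N K) {y : K →L[ℂ] K}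
    {n : ZMod N} (hy : ∀ t, V.conj t y = chi ω (t * n) • y) :
    leg₂ ω U V y = HilbertTensor.map (U.π (-n)) y := by
  refine ext_degree hω U V fun ξ η a b hξ hη => ?_
  rw [leg₂, ContinuousLinearMap.comp_apply, ContinuousLinearMap.comp_apply,
    braid_tmul hω U V hξ hη, map_smul, map_smul, HilbertTensor.map_tmul, one_apply_eq_self,
    dualBraid_tmul hω U V hξ (π_apply_of_degree hω V hy hη), HilbertTensor.map_tmul, hξ,
    HilbertTensor.smul_tmul, smul_smul, ← chi_add hω]
  congr 2
  ring

/-- The braiding intertwines the first leg of a homogeneous operator and the dual twist. -/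
theorem braid_comp_leg₁ (hω : IsPrimitiveRoot ω N) (U : ZNRep N L) (V : ZNRep N K)
    {x : L →L[ℂ] L} {m : ZMod N} (hx : ∀ t, U.conj t x = chi ω (t * m) • x) :
    braid ω U V ∘L leg₁ K x = HilbertTensor.map (V.π m) x ∘L braid ω U V := by
  refine ext_degree hω U V fun ξ η a b hξ hη => ?_
  rw [leg₁, ContinuousLinearMap.comp_apply, ContinuousLinearMap.comp_apply, HilbertTensor.map_tmul,
    one_apply_eq_self, braid_tmul hω U V (π_apply_of_degree hω U hx hξ) hη,
    braid_tmul hω U V hξ hη, map_smul, HilbertTensor.map_tmul, hη, HilbertTensor.smul_tmul,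
    smul_smul, ← chi_add hω]
  congr 2
  ring

theorem braid_comp_leg₂ (hω : IsPrimitiveRoot ω N) (U : ZNRep N L) (V : ZNRep N K)
    (y : K →L[ℂ] K) :
    braid ω U V ∘L leg₂ ω U V y = HilbertTensor.map y 1 ∘L braid ω U V := by
  rw [leg₂, ← ContinuousLinearMap.comp_assoc, braid_comp_dualBraid hω]
  rfl

theorem π_mul_conj_neg (V : ZNRep N K) (m : ZMod N) (y : K →L[ℂ] K) :
    V.π m * V.conj (-m) y = y * V.π m := by
  rw [conj_apply, star_π, neg_neg, ← mul_assoc, ← mul_assoc, ← V.π_add, add_neg_cancel, V.π_zero,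
    one_mul]

/-- Moved across the braiding, `leg₂ y` becomes y ⊗ 1 and `leg₁ x` becomes V_m ⊗ x. The only factors
that fail to commute are y and V_m, and exchanging them conjugates y by V_{-m}. -/
theorem leg₂_mul_leg₁ (hω : IsPrimitiveRoot ω N) (U : ZNRep N L) (V : ZNRep N K)
    {x : L →L[ℂ] L} {m : ZMod N} (hx : ∀ t, U.conj t x = chi ω (t * m) • x) (y : K →L[ℂ] K) :
    leg₂ ω U V y * leg₁ K x = leg₁ K x * leg₂ ω U V (V.conj (-m) y) := by
  have hb : braid ω U V ∘L (leg₂ ω U V y * leg₁ K x) =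
      braid ω U V ∘L (leg₁ K x * leg₂ ω U V (V.conj (-m) y)) := by
    rw [ContinuousLinearMap.mul_def, ContinuousLinearMap.mul_def, ← ContinuousLinearMap.comp_assoc,
      ← ContinuousLinearMap.comp_assoc, braid_comp_leg₁ hω U V hx, braid_comp_leg₂ hω,
      ContinuousLinearMap.comp_assoc, ContinuousLinearMap.comp_assoc, braid_comp_leg₁ hω U V hx,
      braid_comp_leg₂ hω, ← ContinuousLinearMap.comp_assoc, ← ContinuousLinearMap.comp_assoc,
      ← ContinuousLinearMap.mul_def, ← ContinuousLinearMap.mul_def, HilbertTensor.map_mul_map,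
      HilbertTensor.map_mul_map, π_mul_conj_neg, one_mul, mul_one]
  have hd := congrArg (fun T => dualBraid ω U V ∘L T) hb
  simp only [← ContinuousLinearMap.comp_assoc, dualBraid_comp_braid hω] at hd
  exact hd

/-- Since the second leg of y is U_{-n} ⊗ y, only U_{-n} has to pass x. Here homogeneity is needed
of y, while x is arbitrary. -/
theorem leg₂_mul_leg₁_of_degree (hω : IsPrimitiveRoot ω N) (U : ZNRep N L) (V : ZNRep N K)
    (x : L →L[ℂ] L) {y : K →L[ℂ] K} {n : ZMod N} (hy : ∀ t, V.conj t y = chi ω (t * n) • y) :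
    leg₂ ω U V y * leg₁ K x = leg₁ K (U.conj (-n) x) * leg₂ ω U V y := by
  rw [leg₂_of_degree hω U V hy, leg₁, leg₁, HilbertTensor.map_mul_map, HilbertTensor.map_mul_map,
    conj_apply, mul_assoc, (Unitary.mem_iff.mp (U.π_mem _)).1, mul_one, mul_one, one_mul]

end ZNRep

/-! ### Homogeneous elements -/

namespace ZNAction

variable {N : ℕ} [NeZero N] {ω : ℂ} {X Y : Type*} [CStarAlgebra X] [CStarAlgebra Y]
  {α : ZNAction N X} {β : ZNAction N Y}

/-- The elements of degree `m`, those with `ρ_t(x) = ω ^ (t m) x` for all `t`. -/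
def IsHomogeneous (α : ZNAction N X) (ω : ℂ) (m : ZMod N) (x : X) : Prop :=
  ∀ t, α.ρ x t = chi ω (t * m) • x

theorem IsHomogeneous.map {m : ZMod N} {x : X} (hx : α.IsHomogeneous ω m x) {φ : X →⋆ₐ[ℂ] Y}
    (hφ : IsEquivariant α β φ) : β.IsHomogeneous ω m (φ x) := fun t => by
  rw [hφ, hx, map_smul]

theorem IsHomogeneous.star (hω : IsPrimitiveRoot ω N) {m : ZMod N} {x : X}
    (hx : α.IsHomogeneous ω m x) : α.IsHomogeneous ω (-m) (star x) := fun t => by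
  rw [map_star, Pi.star_apply, hx, star_smul, star_chi hω, mul_neg]

/-- The component of degree `m`. -/
def component (α : ZNAction N X) (ω : ℂ) (m : ZMod N) (x : X) : X :=
  (N : ℂ)⁻¹ • ∑ t : ZMod N, chi ω (-(t * m)) • α.ρ x t

/-- Acting by t translates the summation index, which factors out the character value. -/
theorem isHomogeneous_component (hω : IsPrimitiveRoot ω N) (m : ZMod N) (x : X) :
    α.IsHomogeneous ω m (α.component ω m x) := fun t => by
  rw [component, map_smul, Pi.smul_apply, map_sum, Finset.sum_apply, smul_comm (chi ω (t * m))]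
  refine congrArg (fun z : X => (N : ℂ)⁻¹ • z) ?_
  rw [Finset.smul_sum]
  refine Fintype.sum_equiv (Equiv.addLeft t) _ _ fun s => ?_
  rw [map_smul, Pi.smul_apply, α.coassoc, Equiv.coe_addLeft, smul_smul, ← chi_add hω]
  congr 2
  ring

/-- By orthogonality of characters, summing over all degrees leaves only the term t = 0. -/
theorem sum_component (hω : IsPrimitiveRoot ω N) {x : X} (h0 : α.ρ x 0 = x) :
    ∑ m, α.component ω m x = x := by
  have hN : (N : ℂ) ≠ 0 := Nat.cast_ne_zero.mpr (NeZero.ne N)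
  simp only [component]
  rw [← Finset.smul_sum, Finset.sum_comm]
  have h1 : ∀ t : ZMod N, ∑ m : ZMod N, chi ω (-(t * m)) • α.ρ x t =
      if t = 0 then (N : ℂ) • x else 0 := by
    intro t
    rw [← Finset.sum_smul]
    have h2 : ∑ m : ZMod N, chi ω (-(t * m)) = ∑ m : ZMod N, chi ω (m * (-t)) :=
      Finset.sum_congr rfl fun m _ => by congr 1; ring
    rw [h2, sum_chi hω]
    by_cases ht : t = 0
    · simp [ht, h0]
    · simp [ht]
  rw [Finset.sum_congr rfl fun t _ => h1 t]
  simp [smul_smul, hN]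

/-- If the images of two algebras commute up to the action, then the products of their elements
span a `*`-algebra. -/
theorem mem_span_of_mem_adjoin (hω : IsPrimitiveRoot ω N) (h0 : ∀ x, α.ρ x 0 = x)
    {B : Type*} [CStarAlgebra B] {a : X →⋆ₐ[ℂ] B} {b : Y →⋆ₐ[ℂ] B}
    (hab : ∀ m x, α.IsHomogeneous ω m x → ∀ y, b y * a x = a x * b (β.ρ y (-m)))
    {z : B} (hz : z ∈ StarAlgebra.adjoin ℂ {T | ∃ x y, T = a x * b y}) :
    z ∈ Submodule.span ℂ {T | ∃ x y, T = a x * b y} := by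
  -- In a product of two generators the inner factors are in the wrong order. Splitting `x'` into
  -- homogeneous components allows `hab` to exchange them. The adjoint of a generator is the case in
  -- which the outer factors are 1.
  have key : ∀ x x' y y',
      a x * (b y * a x') * b y' ∈ Submodule.span ℂ {T | ∃ x y, T = a x * b y} := by
    intro x x' y y'
    rw [← sum_component hω (h0 x'), map_sum, Finset.mul_sum, Finset.mul_sum, Finset.sum_mul]
    refine Submodule.sum_mem _ fun m _ => ?_
    rw [hab m _ (isHomogeneous_component hω m x'), ← mul_assoc, mul_assoc, ← map_mul, ← map_mul]
    exact Submodule.subset_span ⟨_, _, rfl⟩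
  refine adjoin_subset_span ?_ ?_ ?_ hz
  · exact Submodule.subset_span ⟨1, 1, by rw [map_one, map_one, mul_one]⟩
  · rintro _ ⟨x, y, rfl⟩ _ ⟨x', y', rfl⟩
    have := key x x' y y'
    rwa [← mul_assoc, mul_assoc] at this
  · rintro _ ⟨x, y, rfl⟩
    have := key 1 (star x) (star y) 1
    rwa [map_one, map_one, one_mul, mul_one, map_star, map_star, ← star_mul] at this

end ZNAction

namespace EquivRep

variable {N : ℕ} [NeZero N] {ω : ℂ} {X : Type*} [CStarAlgebra X] {α : ZNAction N X}
  {L : Type*} [NormedAddCommGroup L] [InnerProductSpace ℂ L] [CompleteSpace L]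

theorem conj_hom (θ : EquivRep α L) (t : ZMod N) (x : X) :
    θ.U.conj t (θ.hom x) = θ.hom (α.ρ x t) := (θ.covariant t x).symm

/-- The neutral element acts trivially on operators, and a faithful representation carries this back
to the algebra. -/
theorem ρ_zero (θ : EquivRep α L) (x : X) : α.ρ x 0 = x :=
  θ.injective (by rw [θ.covariant, θ.U.π_zero, star_one, one_mul, mul_one])

theorem conj_hom_of_isHomogeneous (θ : EquivRep α L) {m : ZMod N} {x : X}
    (hx : α.IsHomogeneous ω m x) (t : ZMod N) :
    θ.U.conj t (θ.hom x) = chi ω (t * m) • θ.hom x := by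
  rw [conj_hom, hx, map_smul]

end EquivRep

/-! ### Functoriality of the braided tensor product -/

namespace Braided

variable {N : ℕ} [NeZero N] {ω : ℂ} {X Y X' Y' : Type*} [CStarAlgebra X] [CStarAlgebra Y]
  [CStarAlgebra X'] [CStarAlgebra Y']
  {α : ZNAction N X} {β : ZNAction N Y} {α' : ZNAction N X'} {β' : ZNAction N Y'}
  {L K L' K' : Type*} [NormedAddCommGroup L] [InnerProductSpace ℂ L] [CompleteSpace L]
  [NormedAddCommGroup K] [InnerProductSpace ℂ K] [CompleteSpace K]
  [NormedAddCommGroup L'] [InnerProductSpace ℂ L'] [CompleteSpace L']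
  [NormedAddCommGroup K'] [InnerProductSpace ℂ K'] [CompleteSpace K']

theorem j₂_mul_j₁ (hω : IsPrimitiveRoot ω N) (θ : EquivRep α L) (κ : EquivRep β K) {m : ZMod N}
    {x : X} (hx : α.IsHomogeneous ω m x) (y : Y) :
    j₂ hω θ κ y * j₁ hω θ κ x = j₁ hω θ κ x * j₂ hω θ κ (β.ρ y (-m)) := by
  refine Subtype.ext ?_
  change ZNRep.leg₂ ω θ.U κ.U (κ.hom y) * ZNRep.leg₁ K (θ.hom x) =
    ZNRep.leg₁ K (θ.hom x) * ZNRep.leg₂ ω θ.U κ.U (κ.hom (β.ρ y (-m)))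
  rw [ZNRep.leg₂_mul_leg₁ hω θ.U κ.U (θ.conj_hom_of_isHomogeneous hx), κ.conj_hom]

theorem j₂_mul_j₁_of_isHomogeneous (hω : IsPrimitiveRoot ω N) (θ : EquivRep α L)
    (κ : EquivRep β K) {n : ZMod N} (x : X) {y : Y} (hy : β.IsHomogeneous ω n y) :
    j₂ hω θ κ y * j₁ hω θ κ x = j₁ hω θ κ (α.ρ x (-n)) * j₂ hω θ κ y := by
  refine Subtype.ext ?_
  change ZNRep.leg₂ ω θ.U κ.U (κ.hom y) * ZNRep.leg₁ K (θ.hom x) =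
    ZNRep.leg₁ K (θ.hom (α.ρ x (-n))) * ZNRep.leg₂ ω θ.U κ.U (κ.hom y)
  rw [ZNRep.leg₂_mul_leg₁_of_degree hω θ.U κ.U _ (κ.conj_hom_of_isHomogeneous hy), θ.conj_hom]

/-- The defining density in the bounded operators, transported into the algebra itself, where
homomorphisms out of it can be compared. -/
theorem topologicalClosure_adjoin (hω : IsPrimitiveRoot ω N) (θ : EquivRep α L)
    (κ : EquivRep β K) :
    (StarAlgebra.adjoin ℂ {T | ∃ x y, T = j₁ hω θ κ x * j₂ hω θ κ y}).topologicalClosure = ⊤ := by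
  refine eq_top_iff.mpr fun T _ => ?_
  refine closure_subtype.mpr (closure_mono ?_ T.2)
  have hle : StarAlgebra.adjoin ℂ {T | ∃ x y,
      T = ZNRep.leg₁ K (θ.hom x) * ZNRep.leg₂ ω θ.U κ.U (κ.hom y)} ≤
      (StarAlgebra.adjoin ℂ {T | ∃ x y, T = j₁ hω θ κ x * j₂ hω θ κ y}).map
        (Braided ω θ κ).subtype := by
    refine StarAlgebra.adjoin_le ?_
    rintro _ ⟨x, y, rfl⟩
    exact ⟨j₁ hω θ κ x * j₂ hω θ κ y, StarAlgebra.subset_adjoin ℂ _ ⟨x, y, rfl⟩, rfl⟩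
  exact hle

theorem hom_ext (hω : IsPrimitiveRoot ω N) (θ : EquivRep α L) (κ : EquivRep β K)
    {B : Type*} [CStarAlgebra B] {f g : Braided ω θ κ →⋆ₐ[ℂ] B}
    (h : ∀ x y, f (j₁ hω θ κ x * j₂ hω θ κ y) = g (j₁ hω θ κ x * j₂ hω θ κ y)) : f = g := by
  refine starAlgHom_ext_of_adjoin (topologicalClosure_adjoin hω θ κ) ?_
  rintro _ ⟨x, y, rfl⟩
  exact h x y

/-- The commutation rule makes the linear span of the products j₁(x) j₂(y) a `*`-algebra already, so
no further products are needed for density. -/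
theorem topologicalClosure_span (hω : IsPrimitiveRoot ω N) (θ : EquivRep α L)
    (κ : EquivRep β K) :
    (Submodule.span ℂ {T | ∃ x y, T = j₁ hω θ κ x * j₂ hω θ κ y}).topologicalClosure = ⊤ := by
  refine eq_top_iff.mpr fun T _ => ?_
  have hT : T ∈ (StarAlgebra.adjoin ℂ
      {T | ∃ x y, T = j₁ hω θ κ x * j₂ hω θ κ y}).topologicalClosure := by
    rw [topologicalClosure_adjoin]
    trivial
  exact closure_mono (fun z hz => ZNAction.mem_span_of_mem_adjoin (α := α) (β := β) hω θ.ρ_zero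
    (fun m x hx y => j₂_mul_j₁ hω θ κ hx y) hz) hT

/-- A unital `*`-homomorphism with the values of a braided tensor product of equivariant morphisms
is equivariant. -/
theorem isTensorMap_of_apply_mul (hω : IsPrimitiveRoot ω N) {θ : EquivRep α L} {κ : EquivRep β K}
    {θ' : EquivRep α' L'} {κ' : EquivRep β' K'} {φ : X →⋆ₐ[ℂ] X'} {ψ : Y →⋆ₐ[ℂ] Y'}
    (hφ : ZNAction.IsEquivariant α α' φ) (hψ : ZNAction.IsEquivariant β β' ψ)
    {Φ : Braided ω θ κ →⋆ₐ[ℂ] Braided ω θ' κ'}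
    (hΦ : ∀ x y, Φ (j₁ hω θ κ x * j₂ hω θ κ y) = j₁ hω θ' κ' (φ x) * j₂ hω θ' κ' (ψ y)) :
    IsTensorMap hω θ κ θ' κ' φ ψ Φ := by
  refine ⟨fun T t => ?_, hΦ⟩
  have h : ((action hω θ' κ').at t).comp Φ = Φ.comp ((action hω θ κ).at t) :=
    hom_ext hω θ κ fun x y => by
      have h1 : (action hω θ κ).at t (j₁ hω θ κ x * j₂ hω θ κ y) =
          j₁ hω θ κ (α.ρ x t) * j₂ hω θ κ (β.ρ y t) :=
        (map_mul _ _ _).trans (congrArg₂ _ (j₁_equivariant hω θ κ x t) (j₂_equivariant hω θ κ y t))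
      have h2 : (action hω θ' κ').at t (j₁ hω θ' κ' (φ x) * j₂ hω θ' κ' (ψ y)) =
          j₁ hω θ' κ' (α'.ρ (φ x) t) * j₂ hω θ' κ' (β'.ρ (ψ y) t) :=
        (map_mul _ _ _).trans
          (congrArg₂ _ (j₁_equivariant hω θ' κ' _ t) (j₂_equivariant hω θ' κ' _ t))
      rw [StarAlgHom.comp_apply, StarAlgHom.comp_apply, hΦ, h1, h2, hΦ, hφ, hψ]
  exact DFunLike.congr_fun h T

/-- The operators of the braided tensor product, conjugated by the braiding. -/
def braidCLM (θ : EquivRep α L) (κ : EquivRep β K) :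
    Braided ω θ κ →L[ℂ] (HilbertTensor K L →L[ℂ] HilbertTensor K L) where
  toFun T := ZNRep.braid ω θ.U κ.U ∘L T.1 ∘L ZNRep.dualBraid ω θ.U κ.U
  map_add' S T := by ext z; simp
  map_smul' c T := by ext z; simp
  cont := continuous_const.clm_comp (continuous_subtype_val.clm_comp continuous_const)

theorem braidCLM_injective (hω : IsPrimitiveRoot ω N) (θ : EquivRep α L) (κ : EquivRep β K) :
    Function.Injective (braidCLM (ω := ω) θ κ) := by
  intro S T h
  have h1 : ∀ R : HilbertTensor L K →L[ℂ] HilbertTensor L K,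
      ZNRep.dualBraid ω θ.U κ.U ∘L (ZNRep.braid ω θ.U κ.U ∘L R ∘L ZNRep.dualBraid ω θ.U κ.U) ∘L
        ZNRep.braid ω θ.U κ.U = R := fun R => by
    rw [ContinuousLinearMap.comp_assoc, ContinuousLinearMap.comp_assoc,
      ZNRep.dualBraid_comp_braid hω, ← ContinuousLinearMap.comp_assoc,
      ZNRep.dualBraid_comp_braid hω]
    rfl
  refine Subtype.ext ?_
  rw [← h1 S.1, ← h1 T.1]
  exact congrArg (fun R => ZNRep.dualBraid ω θ.U κ.U ∘L R ∘L ZNRep.braid ω θ.U κ.U) h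

/-- Conjugation by the braiding puts x, untwisted, into the second tensor factor, with the twist V_m
moved to the first. Slicing the first factor therefore returns a multiple of x, as needed for φ ⊠
id. -/
theorem braidCLM_mul (hω : IsPrimitiveRoot ω N) (θ : EquivRep α L) (κ : EquivRep β K) {m : ZMod N}
    {x : X} (hx : α.IsHomogeneous ω m x) (y : Y) :
    braidCLM θ κ (j₁ hω θ κ x * j₂ hω θ κ y) =
      HilbertTensor.map (κ.U.π m * κ.hom y) (θ.hom x) := by
  have h : ZNRep.braid ω θ.U κ.U ∘L (ZNRep.leg₁ K (θ.hom x) ∘L ZNRep.leg₂ ω θ.U κ.U (κ.hom y)) =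
      HilbertTensor.map (κ.U.π m * κ.hom y) (θ.hom x) ∘L ZNRep.braid ω θ.U κ.U := by
    rw [← ContinuousLinearMap.comp_assoc,
      ZNRep.braid_comp_leg₁ hω θ.U κ.U (θ.conj_hom_of_isHomogeneous hx),
      ContinuousLinearMap.comp_assoc, ZNRep.braid_comp_leg₂ hω, ← ContinuousLinearMap.comp_assoc,
      ← ContinuousLinearMap.mul_def, HilbertTensor.map_mul_map, mul_one]
  change ZNRep.braid ω θ.U κ.U ∘L (ZNRep.leg₁ K (θ.hom x) ∘L
    ZNRep.leg₂ ω θ.U κ.U (κ.hom y)) ∘L ZNRep.dualBraid ω θ.U κ.U = _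
  rw [← ContinuousLinearMap.comp_assoc, h, ContinuousLinearMap.comp_assoc,
    ZNRep.braid_comp_dualBraid hω]
  rfl

/-- The inclusion into the bounded operators. -/
def valCLM (θ : EquivRep α L) (κ : EquivRep β K) :
    Braided ω θ κ →L[ℂ] (HilbertTensor L K →L[ℂ] HilbertTensor L K) where
  toFun T := T.1
  map_add' _ _ := rfl
  map_smul' _ _ := rfl
  cont := continuous_subtype_val

/-- Without conjugation it is y that stands untwisted in the second factor, as needed for id ⊠ ψ. -/
theorem valCLM_mul (hω : IsPrimitiveRoot ω N) (θ : EquivRep α L) (κ : EquivRep β K) {n : ZMod N}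
    (x : X) {y : Y} (hy : β.IsHomogeneous ω n y) :
    valCLM θ κ (j₁ hω θ κ x * j₂ hω θ κ y) =
      HilbertTensor.map (θ.hom x * θ.U.π (-n)) (κ.hom y) := by
  change ZNRep.leg₁ K (θ.hom x) * ZNRep.leg₂ ω θ.U κ.U (κ.hom y) = _
  rw [ZNRep.leg₂_of_degree hω θ.U κ.U (κ.conj_hom_of_isHomogeneous hy), ZNRep.leg₁,
    HilbertTensor.map_mul_map, one_mul]

/-- The generators of the graph of a braided tensor product of morphisms. -/
def graphGenerators (hω : IsPrimitiveRoot ω N) (θ : EquivRep α L) (κ : EquivRep β K)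
    (θ' : EquivRep α' L') (κ' : EquivRep β' K') (φ : X →⋆ₐ[ℂ] X') (ψ : Y →⋆ₐ[ℂ] Y') :
    Set (Braided ω θ κ × Braided ω θ' κ') :=
  {z | ∃ x y, z = (j₁ hω θ κ).prod ((j₁ hω θ' κ').comp φ) x *
    (j₂ hω θ κ).prod ((j₂ hω θ' κ').comp ψ) y}

theorem fst_image_graphGenerators (hω : IsPrimitiveRoot ω N) (θ : EquivRep α L)
    (κ : EquivRep β K) (θ' : EquivRep α' L') (κ' : EquivRep β' K') (φ : X →⋆ₐ[ℂ] X')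
    (ψ : Y →⋆ₐ[ℂ] Y') :
    Prod.fst '' graphGenerators hω θ κ θ' κ' φ ψ = {T | ∃ x y, T = j₁ hω θ κ x * j₂ hω θ κ y} := by
  ext T
  constructor
  · rintro ⟨_, ⟨x, y, rfl⟩, rfl⟩
    exact ⟨x, y, rfl⟩
  · rintro ⟨x, y, rfl⟩
    exact ⟨_, ⟨x, y, rfl⟩, rfl⟩

/-- By equivariance the commutation rule has the same form in source and target, so it holds for the
paired embeddings into the product algebra, and the span of the graph generators is a `*`-algebra.
-/
theorem mem_span_graphGenerators (hω : IsPrimitiveRoot ω N) {θ : EquivRep α L}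
    {κ : EquivRep β K} {θ' : EquivRep α' L'} {κ' : EquivRep β' K'} {φ : X →⋆ₐ[ℂ] X'}
    {ψ : Y →⋆ₐ[ℂ] Y'} (hφ : ZNAction.IsEquivariant α α' φ) (hψ : ZNAction.IsEquivariant β β' ψ)
    {z : Braided ω θ κ × Braided ω θ' κ'}
    (hz : z ∈ StarAlgebra.adjoin ℂ (graphGenerators hω θ κ θ' κ' φ ψ)) :
    z ∈ Submodule.span ℂ (graphGenerators hω θ κ θ' κ' φ ψ) := by
  refine ZNAction.mem_span_of_mem_adjoin (α := α) (β := β) hω θ.ρ_zero (fun m x hx y => ?_) hz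
  refine Prod.ext (j₂_mul_j₁ hω θ κ hx y) ?_
  change j₂ hω θ' κ' (ψ y) * j₁ hω θ' κ' (φ x) =
    j₁ hω θ' κ' (φ x) * j₂ hω θ' κ' (ψ (β.ρ y (-m)))
  rw [j₂_mul_j₁ hω θ' κ' (hx.map hφ), hψ]

/-- The braided tensor product `φ ⊠ id`. -/
theorem exists_isTensorMap_left (hω : IsPrimitiveRoot ω N) (θ : EquivRep α L) (κ : EquivRep β K)
    (θ' : EquivRep α' L') {φ : X →⋆ₐ[ℂ] X'} (hφ : ZNAction.IsEquivariant α α' φ) :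
    ∃ Φ, IsTensorMap hω θ κ θ' κ φ (StarAlgHom.id ℂ Y) Φ := by
  have hid : ZNAction.IsEquivariant β β (StarAlgHom.id ℂ Y) := fun _ _ => rfl
  obtain ⟨Φ, hΦ⟩ := HilbertTensor.exists_starAlgHom_of_slice (braidCLM (ω := ω) θ κ)
    (braidCLM (ω := ω) θ' κ) (braidCLM_injective hω θ' κ) θ.hom θ.injective (θ'.hom.comp φ)
    (S := graphGenerators hω θ κ θ' κ φ (StarAlgHom.id ℂ Y))
    (by rw [fst_image_graphGenerators, topologicalClosure_adjoin])
    (fun z hz => mem_span_graphGenerators hω hφ hid hz) (by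
      rintro _ ⟨x, y, rfl⟩ e f
      -- The coefficient of the component of degree m depends only on `κ`, y, e and f, which source
      -- and target share; equivariance of φ preserves the degree. Hence a single element represents
      -- both slices.
      refine ⟨∑ m, inner ℂ e ((κ.U.π m * κ.hom y) f) • α.component ω m x, ?_, ?_⟩
      · change _ = HilbertTensor.slice e f (braidCLM θ κ (j₁ hω θ κ x * j₂ hω θ κ y))
        conv_rhs => rw [← ZNAction.sum_component hω (θ.ρ_zero x)]
        simp only [map_sum, Finset.sum_mul, map_smul]
        refine Finset.sum_congr rfl fun m _ => ?_
        rw [braidCLM_mul hω θ κ (ZNAction.isHomogeneous_component hω m x),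
          HilbertTensor.slice_map]
      · change _ = HilbertTensor.slice e f (braidCLM θ' κ (j₁ hω θ' κ (φ x) * j₂ hω θ' κ y))
        conv_rhs => rw [← ZNAction.sum_component hω (θ.ρ_zero x)]
        simp only [map_sum, Finset.sum_mul, map_smul]
        refine Finset.sum_congr rfl fun m _ => ?_
        rw [braidCLM_mul hω θ' κ ((ZNAction.isHomogeneous_component hω m x).map hφ),
          HilbertTensor.slice_map, StarAlgHom.comp_apply])
  exact ⟨Φ, isTensorMap_of_apply_mul hω hφ hid fun x y => hΦ _ ⟨x, y, rfl⟩⟩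

/-- The braided tensor product `id ⊠ ψ`. -/
theorem exists_isTensorMap_right (hω : IsPrimitiveRoot ω N) (θ : EquivRep α L) (κ : EquivRep β K)
    (κ' : EquivRep β' K') {ψ : Y →⋆ₐ[ℂ] Y'} (hψ : ZNAction.IsEquivariant β β' ψ) :
    ∃ Ψ, IsTensorMap hω θ κ θ κ' (StarAlgHom.id ℂ X) ψ Ψ := by
  have hid : ZNAction.IsEquivariant α α (StarAlgHom.id ℂ X) := fun _ _ => rfl
  obtain ⟨Ψ, hΨ⟩ := HilbertTensor.exists_starAlgHom_of_slice (valCLM (ω := ω) θ κ)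
    (valCLM (ω := ω) θ κ') Subtype.val_injective κ.hom κ.injective (κ'.hom.comp ψ)
    (S := graphGenerators hω θ κ θ κ' (StarAlgHom.id ℂ X) ψ)
    (by rw [fst_image_graphGenerators, topologicalClosure_adjoin])
    (fun z hz => mem_span_graphGenerators hω hid hψ hz) (by
      rintro _ ⟨x, y, rfl⟩ e f
      -- As for φ ⊠ id, with the roles exchanged: the coefficients involve only `θ`, x, e and f, and
      -- equivariance of ψ preserves the degree of the components of y.
      refine ⟨∑ n, inner ℂ e ((θ.hom x * θ.U.π (-n)) f) • β.component ω n y, ?_, ?_⟩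
      · change _ = HilbertTensor.slice e f (valCLM θ κ (j₁ hω θ κ x * j₂ hω θ κ y))
        conv_rhs => rw [← ZNAction.sum_component hω (κ.ρ_zero y)]
        simp only [map_sum, Finset.mul_sum, map_smul]
        refine Finset.sum_congr rfl fun n _ => ?_
        rw [valCLM_mul hω θ κ x (ZNAction.isHomogeneous_component hω n y),
          HilbertTensor.slice_map]
      · change _ = HilbertTensor.slice e f (valCLM θ κ' (j₁ hω θ κ' x * j₂ hω θ κ' (ψ y)))
        conv_rhs => rw [← ZNAction.sum_component hω (κ.ρ_zero y)]
        simp only [map_sum, Finset.mul_sum, map_smul]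
        refine Finset.sum_congr rfl fun n _ => ?_
        rw [valCLM_mul hω θ κ' x ((ZNAction.isHomogeneous_component hω n y).map hψ),
          HilbertTensor.slice_map, StarAlgHom.comp_apply])
  exact ⟨Ψ, isTensorMap_of_apply_mul hω hid hψ fun x y => hΨ _ ⟨x, y, rfl⟩⟩

end Braided

/-! ### The comultiplication -/

theorem map_mem_unitary_of_mem {N : ℕ} [NeZero N] {A B : Type*} [Ring A] [StarRing A] [Algebra ℂ A]
    [StarModule ℂ A] [Ring B] [StarRing B] [Algebra ℂ B] [StarModule ℂ B] (φ : A →⋆ₐ[ℂ] B)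
    {v : Matrix (ZMod N) (ZMod N) A} (hv : v ∈ unitary (Matrix (ZMod N) (ZMod N) A)) :
    v.map φ ∈ unitary (Matrix (ZMod N) (ZMod N) B) := by
  refine (map_mem_unitary_iff φ v).mpr ?_
  rintro r ⟨i, j, rfl | rfl⟩
  · rw [(Unitary.mem_iff.mp hv).1, sub_self, Matrix.zero_apply, map_zero]
  · rw [(Unitary.mem_iff.mp hv).2, sub_self, Matrix.zero_apply, map_zero]

namespace FreeUnitary

variable {N : ℕ} [NeZero N] {ω : ℂ}

theorem isHomogeneous_u (hω : IsPrimitiveRoot ω N) (i j : ZMod N) :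
    (action hω).IsHomogeneous ω (j - i) (u N ω i j) := fun t => rot_u hω t i j

/-- The generators and their adjoints generate a dense subalgebra. -/
theorem induction {P : FreeUnitary N ω → Prop} (hc : IsClosed {x | P x})
    (hs : ∀ c : ℂ, P (algebraMap ℂ _ c)) (hu : ∀ i j, P (u N ω i j))
    (hu' : ∀ i j, P (star (u N ω i j))) (hm : ∀ a b, P a → P b → P (a * b))
    (ha : ∀ a b, P a → P b → P (a + b)) (x : FreeUnitary N ω) : P x := by
  refine CStarCompletion.induction _ hc (fun a => ?_) x
  change P (CStarCompletion.ofHom _ a)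
  induction a using FreeStar.induction with
  | hs c => rw [AlgHomClass.commutes]; exact hs c
  | hl q =>
    rcases q with ⟨⟨i, j⟩, b⟩
    cases b
    · rw [← FreeStar.star_gen, map_star]
      exact hu' i j
    · exact hu i j
  | hm a b iha ihb => rw [map_mul]; exact hm _ _ iha ihb
  | ha a b iha ihb => rw [map_add]; exact ha _ _ iha ihb

variable {L : Type*} [NormedAddCommGroup L] [InnerProductSpace ℂ L] [CompleteSpace L]

/-- The matrix product of the two copies of a matrix over an algebra in its braided square. -/
def comulMatrix (hω : IsPrimitiveRoot ω N) (θ : EquivRep (action hω) L)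
    (w : Matrix (ZMod N) (ZMod N) (FreeUnitary N ω)) :
    Matrix (ZMod N) (ZMod N) (Braided ω θ θ) :=
  w.map (Braided.j₁ hω θ θ) * w.map (Braided.j₂ hω θ θ)

theorem comulMatrix_mem_unitary (hω : IsPrimitiveRoot ω N) (θ : EquivRep (action hω) L)
    {w : Matrix (ZMod N) (ZMod N) (FreeUnitary N ω)} (hw : w ∈ unitary (Matrix _ _ _)) :
    comulMatrix hω θ w ∈ unitary (Matrix (ZMod N) (ZMod N) (Braided ω θ θ)) :=
  mul_mem (map_mem_unitary_of_mem _ hw) (map_mem_unitary_of_mem _ hw)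

theorem comulMatrix_apply (hω : IsPrimitiveRoot ω N) (θ : EquivRep (action hω) L)
    (w : Matrix (ZMod N) (ZMod N) (FreeUnitary N ω)) (i j : ZMod N) :
    comulMatrix hω θ w i j =
      ∑ k, Braided.j₁ hω θ θ (w i k) * Braided.j₂ hω θ θ (w k j) := rfl

/-- Moving u_kj* past u_ik*, of degrees -(j-k) and -(k-i), costs ω^(-(k-i)(j-k)). The weights match
because i(j-i) + (k-i)(j-k) = i(k-i) + k(j-k). This identity is the reason for the twist in the
definition of the conjugate. -/
theorem twistedConj_comulMatrix (hω : IsPrimitiveRoot ω N) (θ : EquivRep (action hω) L) :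
    twistedConj ω (comulMatrix hω θ (u N ω)) = comulMatrix hω θ (twistedConj ω (u N ω)) := by
  ext1 i j
  rw [comulMatrix_apply, twistedConj, Matrix.of_apply, comulMatrix_apply, star_sum,
    Finset.smul_sum]
  refine Finset.sum_congr rfl fun k _ => ?_
  have h := Braided.j₂_mul_j₁ hω θ θ ((isHomogeneous_u hω i k).star hω) (star (u N ω k j))
  rw [((isHomogeneous_u hω k j).star hω) _] at h
  rw [star_mul, ← map_star, ← map_star, h, twistedConj, Matrix.of_apply, Matrix.of_apply,
    map_smul, map_smul, map_smul, mul_smul_comm, smul_mul_assoc, mul_smul_comm, smul_smul,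
    smul_smul, ← chi_add hω, ← chi_add hω]
  congr 2
  ring

/-- The comultiplication of `C(U_N^+(R))`. -/
def comul (hω : IsPrimitiveRoot ω N) (θ : EquivRep (action hω) L) :
    FreeUnitary N ω →⋆ₐ[ℂ] Braided ω θ θ :=
  lift (comulMatrix hω θ (u N ω)) (comulMatrix_mem_unitary hω θ (u_mem_unitary N ω)) (by
    rw [twistedConj_comulMatrix]
    exact comulMatrix_mem_unitary hω θ (twistedConj_u_mem_unitary N ω))

theorem comul_u (hω : IsPrimitiveRoot ω N) (θ : EquivRep (action hω) L) (i j : ZMod N) :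
    comul hω θ (u N ω i j) =
      ∑ k, Braided.j₁ hω θ θ (u N ω i k) * Braided.j₂ hω θ θ (u N ω k j) :=
  lift_u _ _ _ i j

theorem map_comul_u (hω : IsPrimitiveRoot ω N) (θ : EquivRep (action hω) L) :
    (u N ω).map (comul hω θ) = comulMatrix hω θ (u N ω) :=
  Matrix.ext fun i j => comul_u hω θ i j

/-- Thus Δ has the same matrix form on the twisted conjugate as on u, so that arguments from
unitarity also reach the adjoints of the generators. -/
theorem map_comul_twistedConj_u (hω : IsPrimitiveRoot ω N) (θ : EquivRep (action hω) L) :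
    (twistedConj ω (u N ω)).map (comul hω θ) = comulMatrix hω θ (twistedConj ω (u N ω)) := by
  rw [map_twistedConj, map_comul_u, twistedConj_comulMatrix]

/-- Each summand has degree (k-i) + (j-k) = j-i, independently of k. -/
theorem comul_equivariant (hω : IsPrimitiveRoot ω N) (θ : EquivRep (action hω) L) :
    ZNAction.IsEquivariant (action hω) (Braided.action hω θ θ) (comul hω θ) := by
  intro x t
  have h : ((Braided.action hω θ θ).at t).comp (comul hω θ) =
      (comul hω θ).comp ((action hω).at t) := hom_ext fun i j => by
    rw [StarAlgHom.comp_apply, StarAlgHom.comp_apply, ZNAction.at_apply (action hω),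
      isHomogeneous_u hω i j t, map_smul, comul_u, map_sum, Finset.smul_sum]
    refine Finset.sum_congr rfl fun k _ => ?_
    rw [map_mul, ZNAction.at_apply, ZNAction.at_apply,
      (isHomogeneous_u hω i k).map (Braided.j₁_equivariant hω θ θ) t,
      (isHomogeneous_u hω k j).map (Braided.j₂_equivariant hω θ θ) t,
      smul_mul_smul_comm, ← chi_add hω]
    congr 2
    ring
  exact DFunLike.congr_fun h x

end FreeUnitary

/-! ### Coassociativity -/

namespace HilbertTensor

variable {E F G : Type*} [NormedAddCommGroup E] [InnerProductSpace ℂ E] [CompleteSpace E]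
  [NormedAddCommGroup F] [InnerProductSpace ℂ F] [CompleteSpace F]
  [NormedAddCommGroup G] [InnerProductSpace ℂ G] [CompleteSpace G]

theorem ext_tmul_tmul {X : Type*} [NormedAddCommGroup X] [NormedSpace ℂ X]
    {S T : HilbertTensor (HilbertTensor E F) G →L[ℂ] X}
    (h : ∀ x y z, S (tmul (tmul x y) z) = T (tmul (tmul x y) z)) : S = T := by
  refine ext_tmul fun v z => ?_
  have hc : ∀ R : HilbertTensor (HilbertTensor E F) G →L[ℂ] X,
      Continuous fun v => R (tmul v z) := fun R => R.continuous.comp (tmulL_left_continuous z)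
  refine denseRange_coeL.induction_on v (isClosed_eq (hc S) (hc T)) fun w => ?_
  induction w using TensorProduct.induction_on with
  | zero => rw [map_zero, zero_tmul, map_zero, map_zero]
  | tmul x y => exact h x y z
  | add a b ha hb => rw [map_add, add_tmul, map_add, map_add, ha, hb]

theorem conj_assoc_map_map (A : E →L[ℂ] E) (B : F →L[ℂ] F) (C : G →L[ℂ] G) :
    (assoc E F G).conjStarAlgEquiv (map (map A B) C) = map A (map B C) := by
  have h : (assoc E F G : _ →L[ℂ] _) ∘L map (map A B) C =
      map A (map B C) ∘L (assoc E F G : _ →L[ℂ] _) := ext_tmul_tmul fun x y z => by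
    simp [assoc_tmul]
  ext v
  have hv := DFunLike.congr_fun h ((assoc E F G).symm v)
  simpa using hv

end HilbertTensor

namespace ZNRep

variable {N : ℕ} [NeZero N] {ω : ℂ} {L K M : Type*} [NormedAddCommGroup L] [InnerProductSpace ℂ L]
  [CompleteSpace L] [NormedAddCommGroup K] [InnerProductSpace ℂ K] [CompleteSpace K]
  [NormedAddCommGroup M] [InnerProductSpace ℂ M] [CompleteSpace M]

theorem conj_assoc_leg₁_leg₁ (x : L →L[ℂ] L) :
    (HilbertTensor.assoc L K M).conjStarAlgEquiv (leg₁ M (leg₁ K x)) =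
      leg₁ (HilbertTensor K M) x := by
  rw [leg₁, leg₁, leg₁, HilbertTensor.conj_assoc_map_map, HilbertTensor.map_one_one]

/-- For y of degree n, both sides are U_{-n} ⊗ (y ⊗ 1). -/
theorem conj_assoc_leg₁_leg₂ (hω : IsPrimitiveRoot ω N) (U : ZNRep N L) (V : ZNRep N K)
    (W : ZNRep N M) {y : K →L[ℂ] K} {n : ZMod N} (hy : ∀ t, V.conj t y = chi ω (t * n) • y) :
    (HilbertTensor.assoc L K M).conjStarAlgEquiv (leg₁ M (leg₂ ω U V y)) =
      leg₂ ω U (V.tensor W) (leg₁ M y) := by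
  have h : ∀ t, (V.tensor W).conj t (leg₁ M y) = chi ω (t * n) • leg₁ M y := fun t => by
    rw [conj_leg₁, hy]
    exact map_smul (leg₁Hom K M) _ _
  rw [leg₂_of_degree hω U V hy, leg₂_of_degree hω U _ h, leg₁, HilbertTensor.conj_assoc_map_map]
  rfl

/-- The twist of the third leg by the tensor product representation splits as U_{-n} ⊗ V_{-n}, so
both sides are U_{-n} ⊗ (V_{-n} ⊗ z). -/
theorem conj_assoc_leg₂ (hω : IsPrimitiveRoot ω N) (U : ZNRep N L) (V : ZNRep N K)
    (W : ZNRep N M) {z : M →L[ℂ] M} {n : ZMod N} (hz : ∀ t, W.conj t z = chi ω (t * n) • z) :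
    (HilbertTensor.assoc L K M).conjStarAlgEquiv (leg₂ ω (U.tensor V) W z) =
      leg₂ ω U (V.tensor W) (leg₂ ω V W z) := by
  have h : ∀ t, (V.tensor W).conj t (leg₂ ω V W z) = chi ω (t * n) • leg₂ ω V W z := fun t => by
    rw [conj_leg₂ hω, hz]
    exact map_smul (leg₂Hom hω V W) _ _
  rw [leg₂_of_degree hω _ W hz, leg₂_of_degree hω U _ h, leg₂_of_degree hω V W hz]
  exact HilbertTensor.conj_assoc_map_map _ _ _

end ZNRep

namespace FreeUnitary

variable {N : ℕ} [NeZero N] {ω : ℂ} {L : Type*} [NormedAddCommGroup L] [InnerProductSpace ℂ L]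
  [CompleteSpace L]

/-- The associator matches the three embeddings of each generator into the two triple products, and
both iterated comultiplications send u_ij to the (i, j) entry of the product of the three copies of
u. -/
theorem comul_coassoc (hω : IsPrimitiveRoot ω N) (θ : EquivRep (action hω) L)
    {Φ : Braided ω θ θ →⋆ₐ[ℂ] Braided ω (Braided.rep hω θ θ) θ}
    {Ψ : Braided ω θ θ →⋆ₐ[ℂ] Braided ω θ (Braided.rep hω θ θ)}
    (hΦ : Braided.IsTensorMap hω θ θ (Braided.rep hω θ θ) θ (comul hω θ) (StarAlgHom.id ℂ _) Φ)
    (hΨ : Braided.IsTensorMap hω θ θ θ (Braided.rep hω θ θ) (StarAlgHom.id ℂ _) (comul hω θ) Ψ)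
    (x : FreeUnitary N ω) :
    (HilbertTensor.assoc L L L).conjStarAlgEquiv (Φ (comul hω θ x)).1 = (Ψ (comul hω θ x)).1 := by
  let c := (HilbertTensor.assoc L L L).conjStarAlgEquiv.toStarAlgHom
  let F := c.comp (Braided ω (Braided.rep hω θ θ) θ).subtype
  let G := (Braided ω θ (Braided.rep hω θ θ)).subtype
  let F₁ := F.comp (Braided.j₁ hω (Braided.rep hω θ θ) θ)
  let F₂ := F.comp (Braided.j₂ hω (Braided.rep hω θ θ) θ)
  let G₁ := G.comp (Braided.j₁ hω θ (Braided.rep hω θ θ))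
  let G₂ := G.comp (Braided.j₂ hω θ (Braided.rep hω θ θ))
  have h1 : ∀ x, F₁ (Braided.j₁ hω θ θ x) = G₁ x := fun x => ZNRep.conj_assoc_leg₁_leg₁ _
  have h2 : ∀ i j, F₁ (Braided.j₂ hω θ θ (u N ω i j)) = G₂ (Braided.j₁ hω θ θ (u N ω i j)) :=
    fun i j => ZNRep.conj_assoc_leg₁_leg₂ hω θ.U θ.U θ.U
      (θ.conj_hom_of_isHomogeneous (isHomogeneous_u hω i j))
  have h3 : ∀ i j, F₂ (u N ω i j) = G₂ (Braided.j₂ hω θ θ (u N ω i j)) :=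
    fun i j => ZNRep.conj_assoc_leg₂ hω θ.U θ.U θ.U
      (θ.conj_hom_of_isHomogeneous (isHomogeneous_u hω i j))
  have hF : ∀ i j, F (Φ (comul hω θ (u N ω i j))) =
      ∑ k, F₁ (comul hω θ (u N ω i k)) * F₂ (u N ω k j) := fun i j => by
    rw [comul_u, map_sum, map_sum]
    refine Finset.sum_congr rfl fun k _ => ?_
    rw [hΦ.apply_mul, map_mul]
    rfl
  have hG : ∀ i j, G (Ψ (comul hω θ (u N ω i j))) =
      ∑ k, G₁ (u N ω i k) * G₂ (comul hω θ (u N ω k j)) := fun i j => by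
    rw [comul_u, map_sum, map_sum]
    refine Finset.sum_congr rfl fun k _ => ?_
    rw [hΨ.apply_mul, map_mul]
    rfl
  have key : (F.comp Φ).comp (comul hω θ) = (G.comp Ψ).comp (comul hω θ) := hom_ext fun i j => by
    refine (hF i j).trans (Eq.trans ?_ (hG i j).symm)
    simp only [comul_u, map_sum, map_mul, h1, h2, h3, Finset.sum_mul, Finset.mul_sum, mul_assoc]
    -- The two double sums differ only in which of the two inner indices is summed first.
    exact Finset.sum_comm
  exact DFunLike.congr_fun key x

end FreeUnitary

/-! ### Bisimplifiability -/

/-- A bounded operator that maps the elements of `S` into the closed span of `T` maps the closed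
span of `S` into the closed span of `T`. -/
theorem map_mem_topologicalClosure_span {A : Type*} [NormedAddCommGroup A] [NormedSpace ℂ A]
    {f : A →L[ℂ] A} {S T : Set A} (h : ∀ s ∈ S, f s ∈ (Submodule.span ℂ T).topologicalClosure)
    {z : A} (hz : z ∈ (Submodule.span ℂ S).topologicalClosure) :
    f z ∈ (Submodule.span ℂ T).topologicalClosure := by
  have hle : Submodule.span ℂ S ≤ (Submodule.span ℂ T).topologicalClosure.comap f.toLinearMap :=
    Submodule.span_le.mpr h
  exact Submodule.topologicalClosure_minimal _ hle
    ((Submodule.isClosed_topologicalClosure _).preimage f.continuous) hz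

theorem mul_mem_topologicalClosure_span {A : Type*} [NormedRing A] [NormedAlgebra ℂ A] {a : A}
    {S T : Set A} (h : ∀ s ∈ S, a * s ∈ (Submodule.span ℂ T).topologicalClosure)
    {z : A} (hz : z ∈ (Submodule.span ℂ S).topologicalClosure) :
    a * z ∈ (Submodule.span ℂ T).topologicalClosure :=
  map_mem_topologicalClosure_span (f := ContinuousLinearMap.mul ℂ A a) h hz

theorem mul_mem_topologicalClosure_span_right {A : Type*} [NormedRing A] [NormedAlgebra ℂ A]
    {a : A} {S T : Set A} (h : ∀ s ∈ S, s * a ∈ (Submodule.span ℂ T).topologicalClosure)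
    {z : A} (hz : z ∈ (Submodule.span ℂ S).topologicalClosure) :
    z * a ∈ (Submodule.span ℂ T).topologicalClosure :=
  map_mem_topologicalClosure_span (f := (ContinuousLinearMap.mul ℂ A).flip a) h hz

theorem mem_topologicalClosure_span {A : Type*} [NormedAddCommGroup A] [NormedSpace ℂ A]
    {S : Set A} {s : A} (hs : s ∈ S) : s ∈ (Submodule.span ℂ S).topologicalClosure :=
  Submodule.le_topologicalClosure _ (Submodule.subset_span hs)

namespace FreeUnitary

variable {N : ℕ} [NeZero N] {ω : ℂ} {L : Type*} [NormedAddCommGroup L] [InnerProductSpace ℂ L]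
  [CompleteSpace L]

theorem star_u_eq_smul (hω : IsPrimitiveRoot ω N) (i j : ZMod N) :
    star (u N ω i j) = chi ω (i * (j - i)) • twistedConj ω (u N ω) i j := by
  rw [twistedConj, Matrix.of_apply, smul_smul, ← chi_add hω, add_neg_cancel, chi_zero, one_smul]

/-- Multiply Δ(w) = w₁w₂ on the right by the adjoint of w₂. It is applied to u and to its twisted
conjugate. -/
theorem j₁_eq_sum (hω : IsPrimitiveRoot ω N) (θ : EquivRep (action hω) L)
    {w : Matrix (ZMod N) (ZMod N) (FreeUnitary N ω)} (hw : w ∈ unitary (Matrix _ _ _))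
    (hΔ : w.map (comul hω θ) = comulMatrix hω θ w) (i k : ZMod N) :
    Braided.j₁ hω θ θ (w i k) =
      ∑ j, comul hω θ (w i j) * Braided.j₂ hω θ θ (star (w k j)) := by
  have h : w.map (comul hω θ) * star (w.map (Braided.j₂ hω θ θ)) = w.map (Braided.j₁ hω θ θ) := by
    rw [hΔ, comulMatrix, mul_assoc,
      (Unitary.mem_iff.mp (map_mem_unitary_of_mem (Braided.j₂ hω θ θ) hw)).2, mul_one]
  refine (congrFun (congrFun h i) k).symm.trans (Finset.sum_congr rfl fun j _ => ?_)
  rw [map_star]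
  rfl

/-- Multiply Δ(w) = w₁w₂ on the left by the adjoint of w₁. The first leg ends up to the left of Δ,
which dictates the order in which the second density is proved. -/
theorem j₂_eq_sum (hω : IsPrimitiveRoot ω N) (θ : EquivRep (action hω) L)
    {w : Matrix (ZMod N) (ZMod N) (FreeUnitary N ω)} (hw : w ∈ unitary (Matrix _ _ _))
    (hΔ : w.map (comul hω θ) = comulMatrix hω θ w) (k j : ZMod N) :
    Braided.j₂ hω θ θ (w k j) =
      ∑ i, Braided.j₁ hω θ θ (star (w i k)) * comul hω θ (w i j) := by
  have h : star (w.map (Braided.j₁ hω θ θ)) * w.map (comul hω θ) = w.map (Braided.j₂ hω θ θ) := by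
    rw [hΔ, comulMatrix, ← mul_assoc,
      (Unitary.mem_iff.mp (map_mem_unitary_of_mem (Braided.j₁ hω θ θ) hw)).1, one_mul]
  refine (congrFun (congrFun h k) j).symm.trans (Finset.sum_congr rfl fun i _ => ?_)
  rw [map_star]
  rfl

/-- The closed span is stable under left multiplication by Δ(X) and right multiplication by j₂(X).
It therefore suffices to show stability under right multiplication by j₁(X); applied to 1, this
yields every j₁(x) j₂(y). -/
theorem topologicalClosure_span_comul_mul_j₂ (hω : IsPrimitiveRoot ω N)
    (θ : EquivRep (action hω) L) :
    (Submodule.span ℂ {T | ∃ x y, T = comul hω θ x * Braided.j₂ hω θ θ y}).topologicalClosure =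
      ⊤ := by
  set G := {T | ∃ x y, T = comul hω θ x * Braided.j₂ hω θ θ y}
  have hl : ∀ x, ∀ s ∈ (Submodule.span ℂ G).topologicalClosure,
      comul hω θ x * s ∈ (Submodule.span ℂ G).topologicalClosure := fun x s hs => by
    refine mul_mem_topologicalClosure_span ?_ hs
    rintro _ ⟨x', y, rfl⟩
    exact mem_topologicalClosure_span ⟨x * x', y, by rw [map_mul, mul_assoc]⟩
  have hr : ∀ y, ∀ s ∈ (Submodule.span ℂ G).topologicalClosure,
      s * Braided.j₂ hω θ θ y ∈ (Submodule.span ℂ G).topologicalClosure := fun y s hs => by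
    refine mul_mem_topologicalClosure_span_right ?_ hs
    rintro _ ⟨x, y', rfl⟩
    exact mem_topologicalClosure_span ⟨x, y' * y, by rw [map_mul, mul_assoc]⟩
  have hw : ∀ w : Matrix (ZMod N) (ZMod N) (FreeUnitary N ω), w ∈ unitary (Matrix _ _ _) →
      w.map (comul hω θ) = comulMatrix hω θ w → ∀ i k,
      Braided.j₁ hω θ θ (w i k) ∈ (Submodule.span ℂ G).topologicalClosure := fun w h h' i k => by
    rw [j₁_eq_sum hω θ h h']
    exact Submodule.sum_mem _ fun j _ => mem_topologicalClosure_span ⟨_, _, rfl⟩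
  -- For homogeneous b, j₁(b) passes to the left of j₂(y) unchanged and meets Δ(x), where j₁(b)
  -- already lies in the closed span; the outer factors preserve it.
  have hh : ∀ m b, (action hω).IsHomogeneous ω m b →
      Braided.j₁ hω θ θ b ∈ (Submodule.span ℂ G).topologicalClosure →
      ∀ s ∈ (Submodule.span ℂ G).topologicalClosure,
        s * Braided.j₁ hω θ θ b ∈ (Submodule.span ℂ G).topologicalClosure :=
      fun m b hb hbG s hs => by
    refine mul_mem_topologicalClosure_span_right ?_ hs
    rintro _ ⟨x, y, rfl⟩
    rw [mul_assoc, Braided.j₂_mul_j₁ hω θ θ hb]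
    exact hl _ _ (hr _ _ hbG)
  -- Stability under multiplication, unlike mere membership of j₁(b), is inherited by products, so
  -- it can be checked on generators and their adjoints.
  have hP : ∀ b, ∀ s ∈ (Submodule.span ℂ G).topologicalClosure,
      s * Braided.j₁ hω θ θ b ∈ (Submodule.span ℂ G).topologicalClosure := by
    intro b
    refine FreeUnitary.induction (P := fun b => ∀ s ∈ (Submodule.span ℂ G).topologicalClosure,
      s * Braided.j₁ hω θ θ b ∈ (Submodule.span ℂ G).topologicalClosure) ?_ ?_ ?_ ?_ ?_ ?_ b
    · simp only [Set.ofPred_forall]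
      refine isClosed_iInter fun s => isClosed_iInter fun _ => ?_
      exact (Submodule.isClosed_topologicalClosure _).preimage
        (continuous_const.mul (continuous_hom (Braided.j₁ hω θ θ)))
    · intro c s hs
      rw [AlgHomClass.commutes, Algebra.algebraMap_eq_smul_one, mul_smul_comm, mul_one]
      exact Submodule.smul_mem _ c hs
    · exact fun i j => hh _ _ (isHomogeneous_u hω i j)
        (hw _ (u_mem_unitary N ω) (map_comul_u hω θ) i j)
    · refine fun i j => hh _ _ ((isHomogeneous_u hω i j).star hω) ?_
      rw [star_u_eq_smul hω, map_smul]
      exact Submodule.smul_mem _ _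
        (hw _ (twistedConj_u_mem_unitary N ω) (map_comul_twistedConj_u hω θ) i j)
    · intro a b ha hb s hs
      rw [map_mul, ← mul_assoc]
      exact hb _ (ha _ hs)
    · intro a b ha hb s hs
      rw [map_add, mul_add]
      exact add_mem (ha _ hs) (hb _ hs)
  refine top_le_iff.mp ((Braided.topologicalClosure_span hω θ θ).ge.trans ?_)
  refine Submodule.topologicalClosure_minimal _ (Submodule.span_le.mpr ?_)
    (Submodule.isClosed_topologicalClosure _)
  rintro _ ⟨x, y, rfl⟩
  have h1 : (1 : Braided ω θ θ) ∈ (Submodule.span ℂ G).topologicalClosure :=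
    mem_topologicalClosure_span ⟨1, 1, by rw [map_one, map_one, mul_one]⟩
  have h2 := hr y _ (hP x _ h1)
  rwa [one_mul] at h2

/-- The mirror image: the span is stable under j₁(X) on the left and Δ(X) on the right, and left
multiplication by j₂(b) is handled by the commutation rule for homogeneous b, which changes x but
leaves b unchanged. -/
theorem topologicalClosure_span_j₁_mul_comul (hω : IsPrimitiveRoot ω N)
    (θ : EquivRep (action hω) L) :
    (Submodule.span ℂ {T | ∃ x y, T = Braided.j₁ hω θ θ x * comul hω θ y}).topologicalClosure =
      ⊤ := by
  set G := {T | ∃ x y, T = Braided.j₁ hω θ θ x * comul hω θ y}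
  have hl : ∀ x, ∀ s ∈ (Submodule.span ℂ G).topologicalClosure,
      Braided.j₁ hω θ θ x * s ∈ (Submodule.span ℂ G).topologicalClosure := fun x s hs => by
    refine mul_mem_topologicalClosure_span ?_ hs
    rintro _ ⟨x', y, rfl⟩
    exact mem_topologicalClosure_span ⟨x * x', y, by rw [map_mul, mul_assoc]⟩
  have hr : ∀ y, ∀ s ∈ (Submodule.span ℂ G).topologicalClosure,
      s * comul hω θ y ∈ (Submodule.span ℂ G).topologicalClosure := fun y s hs => by
    refine mul_mem_topologicalClosure_span_right ?_ hs
    rintro _ ⟨x, y', rfl⟩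
    exact mem_topologicalClosure_span ⟨x, y' * y, by rw [map_mul, mul_assoc]⟩
  have hw : ∀ w : Matrix (ZMod N) (ZMod N) (FreeUnitary N ω), w ∈ unitary (Matrix _ _ _) →
      w.map (comul hω θ) = comulMatrix hω θ w → ∀ i k,
      Braided.j₂ hω θ θ (w i k) ∈ (Submodule.span ℂ G).topologicalClosure := fun w h h' i k => by
    rw [j₂_eq_sum hω θ h h']
    exact Submodule.sum_mem _ fun j _ => mem_topologicalClosure_span ⟨_, _, rfl⟩
  have hh : ∀ n b, (action hω).IsHomogeneous ω n b →
      Braided.j₂ hω θ θ b ∈ (Submodule.span ℂ G).topologicalClosure →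
      ∀ s ∈ (Submodule.span ℂ G).topologicalClosure,
        Braided.j₂ hω θ θ b * s ∈ (Submodule.span ℂ G).topologicalClosure :=
      fun n b hb hbG s hs => by
    refine mul_mem_topologicalClosure_span ?_ hs
    rintro _ ⟨x, y, rfl⟩
    rw [← mul_assoc, Braided.j₂_mul_j₁_of_isHomogeneous hω θ θ x hb]
    exact hr _ _ (hl _ _ hbG)
  have hP : ∀ b, ∀ s ∈ (Submodule.span ℂ G).topologicalClosure,
      Braided.j₂ hω θ θ b * s ∈ (Submodule.span ℂ G).topologicalClosure := by
    intro b
    refine FreeUnitary.induction (P := fun b => ∀ s ∈ (Submodule.span ℂ G).topologicalClosure,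
      Braided.j₂ hω θ θ b * s ∈ (Submodule.span ℂ G).topologicalClosure) ?_ ?_ ?_ ?_ ?_ ?_ b
    · simp only [Set.ofPred_forall]
      refine isClosed_iInter fun s => isClosed_iInter fun _ => ?_
      exact (Submodule.isClosed_topologicalClosure _).preimage
        ((continuous_hom (Braided.j₂ hω θ θ)).mul continuous_const)
    · intro c s hs
      rw [AlgHomClass.commutes, Algebra.algebraMap_eq_smul_one, smul_mul_assoc, one_mul]
      exact Submodule.smul_mem _ c hs
    · exact fun i j => hh _ _ (isHomogeneous_u hω i j)
        (hw _ (u_mem_unitary N ω) (map_comul_u hω θ) i j)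
    · refine fun i j => hh _ _ ((isHomogeneous_u hω i j).star hω) ?_
      rw [star_u_eq_smul hω, map_smul]
      exact Submodule.smul_mem _ _
        (hw _ (twistedConj_u_mem_unitary N ω) (map_comul_twistedConj_u hω θ) i j)
    · intro a b ha hb s hs
      rw [map_mul, mul_assoc]
      exact ha _ (hb _ hs)
    · intro a b ha hb s hs
      rw [map_add, add_mul]
      exact add_mem (ha _ hs) (hb _ hs)
  refine top_le_iff.mp ((Braided.topologicalClosure_span hω θ θ).ge.trans ?_)
  refine Submodule.topologicalClosure_minimal _ (Submodule.span_le.mpr ?_)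
    (Submodule.isClosed_topologicalClosure _)
  rintro _ ⟨x, y, rfl⟩
  have h1 : (1 : Braided ω θ θ) ∈ (Submodule.span ℂ G).topologicalClosure :=
    mem_topologicalClosure_span ⟨1, 1, by rw [map_one, map_one, mul_one]⟩
  have h2 := hl x _ (hP y _ h1)
  rwa [mul_one] at h2

/-- Taking adjoints reverses the products j₁(x) Δ(y), and the adjoint is continuous. -/
theorem topologicalClosure_span_comul_mul_j₁ (hω : IsPrimitiveRoot ω N)
    (θ : EquivRep (action hω) L) :
    (Submodule.span ℂ {T | ∃ x y, T = comul hω θ x * Braided.j₁ hω θ θ y}).topologicalClosure =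
      ⊤ := by
  refine eq_top_iff.mpr fun z _ => ?_
  have hz : star z ∈ (Submodule.span ℂ
      {T | ∃ x y, T = Braided.j₁ hω θ θ x * comul hω θ y}).topologicalClosure := by
    rw [topologicalClosure_span_j₁_mul_comul]
    trivial
  have h := map_mem_closure (t := (Submodule.span ℂ
    {T | ∃ x y, T = comul hω θ x * Braided.j₁ hω θ θ y} : Set (Braided ω θ θ)))
    continuous_star hz fun s hs => by
      induction hs using Submodule.span_induction with
      | mem s hs =>
        obtain ⟨x, y, rfl⟩ := hs
        refine Submodule.subset_span ⟨star y, star x, ?_⟩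
        rw [star_mul, map_star, map_star]
      | zero => rw [star_zero]; exact zero_mem _
      | add s t _ _ hs ht => rw [star_add]; exact add_mem hs ht
      | smul c s _ hs => rw [star_smul]; exact Submodule.smul_mem _ _ hs
  rwa [star_star] at h

end FreeUnitary

end

/-! ### The anyonic free unitary quantum group -/

theorem proposition2 {N : ℕ} [NeZero N] {ω : ℂ} (hω : IsPrimitiveRoot ω N) :
    (∃ (L : Type) (_ : NormedAddCommGroup L) (_ : InnerProductSpace ℂ L) (_ : CompleteSpace L),
      Nonempty (EquivRep (FreeUnitary.action hω) L)) ∧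
    ∀ (L : Type*) [NormedAddCommGroup L] [InnerProductSpace ℂ L] [CompleteSpace L]
      (θ : EquivRep (FreeUnitary.action hω) L),
      ∃ Δ : FreeUnitary N ω →⋆ₐ[ℂ] Braided ω θ θ,
        (∀ i j, Δ (FreeUnitary.u N ω i j) = ∑ k, Braided.j₁ hω θ θ (FreeUnitary.u N ω i k) *
          Braided.j₂ hω θ θ (FreeUnitary.u N ω k j)) ∧
        (∀ Δ' : FreeUnitary N ω →⋆ₐ[ℂ] Braided ω θ θ,
          (∀ i j, Δ' (FreeUnitary.u N ω i j) = ∑ k, Braided.j₁ hω θ θ (FreeUnitary.u N ω i k) *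
            Braided.j₂ hω θ θ (FreeUnitary.u N ω k j)) → Δ' = Δ) ∧
        IsAnyonicCQG hω θ Δ := by
  refine ⟨exists_equivRep _ fun x => DFunLike.congr_fun (FreeUnitary.hom_ext
    (f := FreeUnitary.rot hω 0) (g := StarAlgHom.id ℂ _) fun i j => by
      rw [FreeUnitary.rot_u, zero_mul, chi_zero, one_smul]; rfl) x, fun L _ _ _ θ => ?_⟩
  have heq := FreeUnitary.comul_equivariant hω θ
  refine ⟨FreeUnitary.comul hω θ, FreeUnitary.comul_u hω θ, fun Δ' h => FreeUnitary.hom_ext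
    fun i j => (h i j).trans (FreeUnitary.comul_u hω θ i j).symm, heq, ?_,
    FreeUnitary.topologicalClosure_span_comul_mul_j₂ hω θ,
    FreeUnitary.topologicalClosure_span_comul_mul_j₁ hω θ⟩
  obtain ⟨Φ, hΦ⟩ := Braided.exists_isTensorMap_left hω θ θ (Braided.rep hω θ θ) heq
  obtain ⟨Ψ, hΨ⟩ := Braided.exists_isTensorMap_right hω θ θ (Braided.rep hω θ θ) heq
  refine ⟨Φ, Ψ, hΦ, hΨ, fun x ξ => ?_⟩
  have h := DFunLike.congr_fun (FreeUnitary.comul_coassoc hω θ hΦ hΨ x)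
    (HilbertTensor.assoc L L L ξ)
  -- Evaluating at the image of ξ under the associator turns the equality of conjugated operators
  -- into the intertwining form.
  rwa [LinearIsometryEquiv.conjStarAlgEquiv_apply_apply, LinearIsometryEquiv.symm_apply_apply] at h
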